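/- Throughout, $\|\cdot\|$ is the Euclidean norm of vectors and the operator norm of matrices and tensors. Let $d\ge 2$, $d_z\ge 1$, $m\ge 0$ be integers, and let $\Phi\subseteq\mathbb R^m$ be open and convex (for instance $\Phi=\mathbb R^m$). **Setting.** Let $k:\mathbb R^d\times\mathbb R^d\to\mathbb R$ be a positive semi-definite kernel with reproducing kernel Hilbert space $\mathcal H_0$, and $\mathcal H=\mathcal H_0^{d}$. Let $p:\mathbb R^d\to(0,\infty)$ be the target density (possibly unnormalized), with score $s_p=\nabla\log p$. Let $q(z)$ be a probability distribution on $\mathbb R^{d_z}$, and for $\phi\in\Phi$, $z\in\mathbb R^{d_z}$ let $\mu(z;\phi),\sigma(z;\phi)\in\mathbb R^d$ be measurable in $z$. Put $q_\phi(x)=\int q_\phi(x|z)\,q(\mathrm dz)$, where $q_\phi(\cdot|z)$ is the density of $\mathcal N(\mu(z;\phi),\mathrm{diag}\{\sigma^2(z;\phi)\})$. The loss is $$\mathcal L(\phi)=\mathrm{KSD}(q_\phi\|p)^2=\Big\|S_{q_\phi,k}\nabla\log\frac{p}{q_\phi}\Big\|_{\mathcal H}^2,\qquad (S_{q,k}f)(\cdot)=\int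 k(\cdot,y)f(y)\,q(y)\,\mathrm dy \quad\text{(coordinatewise)}.$$ **Assumptions.** There are constants $B>0$, $L>0$, $M$, $G\ge1$, $s$, $a$ such that: 1. $k$ is twice differentiable and $\max\{k,\|\nabla_1k\|,\|\nabla_{11}k\|,\|\nabla_{12}k\|\}\le B^2$ on $\mathbb R^d\times\mathbb R^d$. 2. $\log p$ is three times continuously differentiable, $\|\nabla^2\log p\|\le L$ and $\|\nabla^3\log p\|\le M$ on $\mathbb R^d$. 3. $\mu$ and $\sigma$ are twice differentiable in $\phi$, and for all $z$ and all $\phi\in\Phi$, $\max\{\|\nabla_\phi\mu(z;\phi)\|,\|\nabla^2_\phi\mu(z;\phi)\|\}\le G(1+\|z\|)$; the same holds for $\sigma$; moreover $\sigma_i(z;\phi)\ge 1/\sqrt L$ for every coordinate $i$. 4. $\mathbb E_{q(z)}\|z\|^4\le a\,d_z^2$, and $\mathbb E_{q_\phi(x)}\|x\|^4\le s^4$ for all $\phi\in\Phi$. Let $x^*$ be any zero of $s_p$ and let $C=L^2\sqrt{s^4+\|x^*\|^4}$. **Theorem.** For every $\phi\in\Phi$ one has $\nabla\log(p/q_\phi)\in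 L^2(q_\phi)$ (so that $\mathcal L(\phi)$ is well defined), and $\mathcal L$ is $L_\phi$-smooth on $\Phi$, i.e. differentiable with $\|\nabla\mathcal L(\phi)-\nabla\mathcal L(\psi)\|\le L_\phi\|\phi-\psi\|$ for all $\phi,\psi\in\Phi$, where $$L_\phi\le A\,B^2G^2d_z\log d\,\big[(1\vee L)^3+Ld+M^2+C\big]$$ with a constant $A>0$ that depends only on $a$. -/

import Mathlib

open MeasureTheory ProbabilityTheory
open scoped NNReal ENNReal Gradient

noncomputable section

namespace KSIVI

/-! ### Kernel Stein discrepancy -/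

/-- The integral operator `S_{q,k}`, acting on scalar functions `g`, with values in the reproducing
kernel Hilbert space `H` of `k`: `S_{q,k} g = ∫ k(·, y) g(y) dq(y)`.  Here `RKHS.kerFun H y 1` is
the element `k(·, y)` of `H`. -/
def integralOperator {d : ℕ} (H : Type*) [NormedAddCommGroup H] [InnerProductSpace ℝ H]
    [CompleteSpace H] [RKHS ℝ H (EuclideanSpace ℝ (Fin d)) ℝ]
    (q : Measure (EuclideanSpace ℝ (Fin d))) (g : EuclideanSpace ℝ (Fin d) → ℝ) : H :=
  ∫ y, g y • RKHS.kerFun H y (1 : ℝ) ∂q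

/-- As a function on `ℝ^d`, `S_{q,k} g` is `x ↦ ∫ k(x, y) g(y) dq(y)`. -/
theorem integralOperator_apply {d : ℕ} (H : Type*) [NormedAddCommGroup H]
    [InnerProductSpace ℝ H] [CompleteSpace H] [RKHS ℝ H (EuclideanSpace ℝ (Fin d)) ℝ]
    (q : Measure (EuclideanSpace ℝ (Fin d))) (g : EuclideanSpace ℝ (Fin d) → ℝ)
    (hg : Integrable (fun y => g y • RKHS.kerFun H y (1 : ℝ)) q)
    (x : EuclideanSpace ℝ (Fin d)) :
    integralOperator H q g x = ∫ y, RKHS.kernel H x y (1 : ℝ) * g y ∂q := by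
  have h := ((RKHS.kerFun H x).adjoint).integral_comp_comm hg
  simp only [RKHS.adjoint_kerFun] at h
  rw [integralOperator, ← h]
  congr 1
  funext y
  simp [RKHS.kerFun_apply, mul_comm]

/-- The norm in the `d`-fold product of `H` of `S_{q,k} g`, for a vector valued function `g`, on
which `S_{q,k}` acts coordinatewise. -/
def integralOperatorNorm {d : ℕ} (H : Type*) [NormedAddCommGroup H] [InnerProductSpace ℝ H]
    [CompleteSpace H] [RKHS ℝ H (EuclideanSpace ℝ (Fin d)) ℝ]
    (q : Measure (EuclideanSpace ℝ (Fin d)))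
    (g : EuclideanSpace ℝ (Fin d) → EuclideanSpace ℝ (Fin d)) : ℝ :=
  √(∑ i, ‖integralOperator H q (fun y => g y i)‖ ^ 2)

/-- The measure with density `q` with respect to Lebesgue measure. -/
def densityMeasure {d : ℕ} (q : EuclideanSpace ℝ (Fin d) → ℝ) :
    Measure (EuclideanSpace ℝ (Fin d)) :=
  volume.withDensity (fun x => ENNReal.ofReal (q x))

/-- The gradient `∇ log (p / q)` of the log-ratio of two densities. -/
def gradLogRatio {d : ℕ} (p q : EuclideanSpace ℝ (Fin d) → ℝ) :
    EuclideanSpace ℝ (Fin d) → EuclideanSpace ℝ (Fin d) :=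
  ∇ (fun x => Real.log (p x / q x))

/-- The kernel Stein discrepancy `KSD(q‖p) = ‖S_{q,k} ∇ log (p/q)‖` between the densities `q` and
`p`, for the kernel of the reproducing kernel Hilbert space `H`. -/
def ksd {d : ℕ} (H : Type*) [NormedAddCommGroup H] [InnerProductSpace ℝ H]
    [CompleteSpace H] [RKHS ℝ H (EuclideanSpace ℝ (Fin d)) ℝ]
    (q p : EuclideanSpace ℝ (Fin d) → ℝ) : ℝ :=
  integralOperatorNorm H (densityMeasure q) (gradLogRatio p q)

/-! ### The semi-implicit variational family -/

/-- The density at `x` of the diagonal Gaussian `N(m, diag(s²))` on `ℝ^d`. -/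
def diagGaussianDensity {d : ℕ} (m s x : EuclideanSpace ℝ (Fin d)) : ℝ :=
  ∏ i, gaussianPDFReal (m i) (‖s i‖₊ ^ 2) (x i)

/-- The density `q_φ(x) = ∫ q_φ(x|z) dq(z)` of the semi-implicit distribution with mixing
distribution `ν` and conditional layer `q_φ(·|z) = N(μ(z;φ), diag(σ²(z;φ)))`. -/
def mixtureDensity {dz d m : ℕ} (ν : Measure (EuclideanSpace ℝ (Fin dz)))
    (μ σ : EuclideanSpace ℝ (Fin dz) → EuclideanSpace ℝ (Fin m) → EuclideanSpace ℝ (Fin d))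
    (φ : EuclideanSpace ℝ (Fin m)) : EuclideanSpace ℝ (Fin d) → ℝ :=
  fun x => ∫ z, diagGaussianDensity (μ z φ) (σ z φ) x ∂ν

/-- The loss `φ ↦ KSD(q_φ‖p)²`. -/
def loss {dz d m : ℕ} (H : Type*) [NormedAddCommGroup H] [InnerProductSpace ℝ H]
    [CompleteSpace H] [RKHS ℝ H (EuclideanSpace ℝ (Fin d)) ℝ]
    (p : EuclideanSpace ℝ (Fin d) → ℝ) (ν : Measure (EuclideanSpace ℝ (Fin dz)))
    (μ σ : EuclideanSpace ℝ (Fin dz) → EuclideanSpace ℝ (Fin m) → EuclideanSpace ℝ (Fin d))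
    (φ : EuclideanSpace ℝ (Fin m)) : ℝ :=
  ksd H (mixtureDensity ν μ σ φ) p ^ 2

/-! ### Assumptions and smoothness -/

/-- `k` is twice differentiable, and `k`, `∇₁k`, `∇₁₁k`, `∇₁₂k` are bounded by `B²`
(Euclidean and operator norms). -/
structure BoundedKernel {d : ℕ}
    (k : EuclideanSpace ℝ (Fin d) → EuclideanSpace ℝ (Fin d) → ℝ) (B : ℝ) : Prop where
  differentiable : Differentiable ℝ (Function.uncurry k)
  differentiable_fderiv : Differentiable ℝ (fderiv ℝ (Function.uncurry k))
  bound : ∀ x y, k x y ≤ B ^ 2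
  bound_one : ∀ x y, ‖fderiv ℝ (fun x' => k x' y) x‖ ≤ B ^ 2
  bound_one_one : ∀ x y,
    ‖fderiv ℝ (fun x'' => fderiv ℝ (fun x' => k x' y) x'') x‖ ≤ B ^ 2
  bound_one_two : ∀ x y,
    ‖fderiv ℝ (fun y' => fderiv ℝ (fun x' => k x' y') x) y‖ ≤ B ^ 2

/-- `log p` is three times continuously differentiable, with `‖∇² log p‖ ≤ L` and
`‖∇³ log p‖ ≤ M` (operator norms), where `p` is positive. -/
structure SmoothTarget {d : ℕ} (p : EuclideanSpace ℝ (Fin d) → ℝ) (L M : ℝ) : Prop where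
  pos : ∀ x, 0 < p x
  contDiff : ContDiff ℝ 3 (fun x => Real.log (p x))
  bound_two : ∀ x, ‖iteratedFDeriv ℝ 2 (fun y => Real.log (p y)) x‖ ≤ L
  bound_three : ∀ x, ‖iteratedFDeriv ℝ 3 (fun y => Real.log (p y)) x‖ ≤ M

/-- `f(z;φ)` is measurable in `z` and twice differentiable in `φ ∈ Φ`, with
`‖∇_φ f(z;φ)‖, ‖∇²_φ f(z;φ)‖ ≤ G (1 + ‖z‖)` (operator norms). -/
structure NetworkGrowth {dz d m : ℕ} (Φ : Set (EuclideanSpace ℝ (Fin m)))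
    (f : EuclideanSpace ℝ (Fin dz) → EuclideanSpace ℝ (Fin m) → EuclideanSpace ℝ (Fin d))
    (G : ℝ) : Prop where
  measurable : ∀ φ ∈ Φ, Measurable (fun z => f z φ)
  differentiableOn : ∀ z, DifferentiableOn ℝ (f z) Φ
  differentiableOn_fderiv : ∀ z, DifferentiableOn ℝ (fderiv ℝ (f z)) Φ
  bound_one : ∀ z, ∀ φ ∈ Φ, ‖fderiv ℝ (f z) φ‖ ≤ G * (1 + ‖z‖)
  bound_two : ∀ z, ∀ φ ∈ Φ, ‖fderiv ℝ (fderiv ℝ (f z)) φ‖ ≤ G * (1 + ‖z‖)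

/-- `f` is `K`-smooth on the open set `Φ`: it is differentiable there and its gradient is
`K`-Lipschitz on `Φ`. -/
def IsSmoothOn {m : ℕ} (K : ℝ) (f : EuclideanSpace ℝ (Fin m) → ℝ)
    (Φ : Set (EuclideanSpace ℝ (Fin m))) : Prop :=
  (∀ φ ∈ Φ, DifferentiableAt ℝ f φ) ∧
    ∀ φ ∈ Φ, ∀ ψ ∈ Φ, ‖∇ f φ - ∇ f ψ‖ ≤ K * ‖φ - ψ‖

end KSIVI

end

noncomputable section

namespace KSIVI

/-! ### Energies of smooth families with respect to a smooth kernel -/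

section Energy

open Filter Topology

/-! The score of the mixture `q_φ` is intractable, but the loss only sees it integrated against
`k(·, x) q_φ(x) dx`. At x it is the average of the conditional scores under the posterior of z given
x, so by Fubini the integral is unchanged when the conditional score under the joint law of (z, x)
takes its place. Sampling x as X = μ(z;φ) + σ(z;φ) ⊙ ξ with ξ standard Gaussian turns the
conditional score into -ξ/σ. Expanding the squared norm in the RKHS then gives (`ksd_mixture_sq`)
loss(φ) = E k(X, X') ⟨f, f'⟩ with f = ∇ log p(X) + ξ/σ, over two independent copies of (z, ξ). The
law of (z, ξ) does not depend on φ and the integrand is explicit, so what is left is differentiation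
under the integral sign.

Put b = G (1 + ‖z‖)(1 + max |ξ_i|) and l = M + 4L + 2L√L. The derivative of X in φ is bounded by b
and b-Lipschitz; that of f is bounded by l b and (l b²)-Lipschitz (`smoothFamily_reparam`). Changing
one factor at a time, the derivative of the integrand moves by at most 9 B² (b² + b'²) T T' ‖φ - ψ‖,
where T = ‖f(φ)‖ + ‖f(ψ)‖ + l. By independence and Cauchy–Schwarz the gradient of the loss has
Lipschitz constant 18 B² β τ² as soon as E b⁴ ≤ β² and E T² ≤ τ²
(`isSmoothOn_integral_interaction`).

The moments give the stated constant. Multiplication by ξ is a diagonal operator, so the noise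
enters b only through its largest coordinate, and β is of order G² d_z log d
(`integral_envelope_pow_four_le`). The bracket is τ²: the target score contributes C, the noise term
ξ/σ contributes L d (`integral_scoreGap_sq_le`), and l² contributes M² + (1 ∨ L)³. -/

/-- The derivative at a point of a parametrized family of measurable functions is measurable. -/
theorem aestronglyMeasurable_of_hasFDerivAt {α : Type*} [MeasurableSpace α] {P : Measure α} {m : ℕ}
    {F : EuclideanSpace ℝ (Fin m) → α → ℝ} {F' : α → EuclideanSpace ℝ (Fin m) →L[ℝ] ℝ}
    {φ : EuclideanSpace ℝ (Fin m)} (hF : ∀ᶠ ψ in 𝓝 φ, AEStronglyMeasurable (F ψ) P)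
    (hF' : ∀ a, HasFDerivAt (fun ψ => F ψ a) (F' a) φ) : AEStronglyMeasurable F' P := by
  have key : ∀ v, AEStronglyMeasurable (fun a => F' a v) P := by
    intro v
    have hto : Tendsto (fun n : ℕ => φ + (n : ℝ)⁻¹ • v) atTop (𝓝 φ) := by
      have h : Tendsto (fun n : ℕ => (n : ℝ)⁻¹) atTop (𝓝 0) := tendsto_inv_atTop_nhds_zero_nat
      simpa using (h.smul_const v).const_add φ
    -- A directional derivative is the limit of the difference quotients with step 1/n.
    -- Measurability is known only for parameters near φ, so the sequence starts at N.
    obtain ⟨N, hN⟩ := eventually_atTop.1 (hto.eventually hF)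
    have hφ : AEStronglyMeasurable (F φ) P := hF.self_of_nhds
    refine aestronglyMeasurable_of_tendsto_ae (u := atTop)
      (f := fun n a => ((n + N : ℕ) : ℝ) • (F (φ + ((n + N : ℕ) : ℝ)⁻¹ • v) a - F φ a))
      (fun n => ((hN (n + N) (Nat.le_add_left _ _)).sub hφ).const_smul ((n + N : ℕ) : ℝ)) ?_
    refine Eventually.of_forall fun a => ?_
    have hc : Tendsto (fun n : ℕ => ‖(n : ℝ)‖) atTop atTop := by
      simpa using tendsto_natCast_atTop_atTop (R := ℝ)
    have := (hF' a).lim_real v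
    have h2 := this.comp (tendsto_natCast_atTop_atTop (R := ℝ))
    exact (tendsto_add_atTop_iff_nat N).2 h2
  have hsum : F' = fun a => ∑ i, (F' a (EuclideanSpace.single i 1)) •
      (EuclideanSpace.proj i : EuclideanSpace ℝ (Fin m) →L[ℝ] ℝ) := by
    funext a
    ext v
    have hv : v = ∑ i, v i • EuclideanSpace.single i (1 : ℝ) := by
      ext j
      simp [Finset.sum_apply, Pi.single_apply]
    conv_lhs => rw [hv]
    simp [mul_comm]
  rw [hsum]
  exact Finset.aestronglyMeasurable_fun_sum _ fun i _ => (key _).smul_const _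

variable {E V Ω : Type*} [NormedAddCommGroup E] [InnerProductSpace ℝ E]
  [NormedAddCommGroup V] [NormedSpace ℝ V]

theorem norm_smul_comp_le {c : ℝ} {q : E →L[ℝ] ℝ} {A : V →L[ℝ] E} {c₀ q₀ A₀ : ℝ} (hc : |c| ≤ c₀)
    (hq : ‖q‖ ≤ q₀) (hA : ‖A‖ ≤ A₀) : ‖c • q.comp A‖ ≤ c₀ * (q₀ * A₀) := by
  rw [norm_smul, Real.norm_eq_abs]
  have := (abs_nonneg c).trans hc
  have := (norm_nonneg q).trans hq
  gcongr
  exact (ContinuousLinearMap.opNorm_comp_le _ _).trans (by gcongr)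

theorem abs_inner_le {u v : E} {u₀ v₀ : ℝ} (hu : ‖u‖ ≤ u₀) (hv : ‖v‖ ≤ v₀) :
    |inner ℝ u v| ≤ u₀ * v₀ := by
  have := (norm_nonneg u).trans hu
  exact (abs_real_inner_le_norm u v).trans (by gcongr)

/-- A symmetric kernel `k`, bounded by `K` together with its partial derivative `k₁` in the first
variable, which is moreover `K`-Lipschitz. -/
structure SmoothKernel (k : E → E → ℝ) (k₁ : E → E → E →L[ℝ] ℝ) (K : ℝ) : Prop where
  symm : ∀ x y, k x y = k y x
  hasFDerivAt : ∀ x y, HasFDerivAt (Function.uncurry k) ((k₁ x y).coprod (k₁ y x)) (x, y)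
  abs_le : ∀ x y, |k x y| ≤ K
  norm_le : ∀ x y, ‖k₁ x y‖ ≤ K
  lipschitz : ∀ x y x' y', ‖k₁ x y - k₁ x' y'‖ ≤ K * (‖x - x'‖ + ‖y - y'‖)

theorem SmoothKernel.nonneg {k : E → E → ℝ} {k₁ : E → E → E →L[ℝ] ℝ} {K : ℝ}
    (hk : SmoothKernel k k₁ K) : 0 ≤ K :=
  (abs_nonneg _).trans (hk.abs_le 0 0)

/-- The bound on `k₁` and the mean value inequality handle the first variable; symmetry of the
kernel transfers this to the second. -/
theorem SmoothKernel.abs_sub_le {k : E → E → ℝ} {k₁ : E → E → E →L[ℝ] ℝ} {K : ℝ}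
    (hk : SmoothKernel k k₁ K) (x y x' y' : E) :
    |k x y - k x' y'| ≤ K * (‖x - x'‖ + ‖y - y'‖) := by
  have h1 : ∀ x x' y, |k x y - k x' y| ≤ K * ‖x - x'‖ := by
    intro x x' y
    have hd : ∀ w ∈ (Set.univ : Set E),
        HasFDerivWithinAt (fun w => k w y) (k₁ w y) Set.univ w := by
      intro w _
      have h2 : HasFDerivAt (fun w : E => (w, y)) ((ContinuousLinearMap.id ℝ E).prod 0) w :=
        (hasFDerivAt_id w).prodMk (hasFDerivAt_const y w)
      have h3 := HasFDerivAt.comp w (hk.hasFDerivAt w y) h2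
      refine (h3.congr_fderiv ?_).hasFDerivWithinAt
      ext v; simp
    exact convex_univ.norm_image_sub_le_of_norm_hasFDerivWithin_le hd
      (fun w _ => hk.norm_le w y) (Set.mem_univ _) (Set.mem_univ _)
  have h2 := h1 x x' y
  have h3 := h1 y y' x'
  rw [hk.symm y x', hk.symm y' x'] at h3
  calc |k x y - k x' y'| ≤ |k x y - k x' y| + |k x' y - k x' y'| := _root_.abs_sub_le _ _ _
    _ ≤ _ := by linarith

/-- A family of points `x` and of vectors `f`, indexed by `ω` and depending on a parameter `φ ∈ Φ`,
with derivatives of growth and Lipschitz constants controlled by `b`. -/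
structure SmoothFamily (Φ : Set V) (x f : Ω → V → E) (x' f' : Ω → V → V →L[ℝ] E) (b : Ω → ℝ)
    (l : ℝ) : Prop where
  one_le : ∀ ω, 1 ≤ b ω
  nonneg : 0 ≤ l
  hasFDerivAt_point : ∀ ω, ∀ φ ∈ Φ, HasFDerivAt (x ω) (x' ω φ) φ
  hasFDerivAt_vector : ∀ ω, ∀ φ ∈ Φ, HasFDerivAt (f ω) (f' ω φ) φ
  point_le : ∀ ω, ∀ φ ∈ Φ, ‖x' ω φ‖ ≤ b ω
  vector_le : ∀ ω, ∀ φ ∈ Φ, ‖f' ω φ‖ ≤ l * b ω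
  point_lip : ∀ ω, ∀ φ ∈ Φ, ∀ ψ ∈ Φ, ‖x' ω φ - x' ω ψ‖ ≤ b ω * ‖φ - ψ‖
  vector_lip : ∀ ω, ∀ φ ∈ Φ, ∀ ψ ∈ Φ, ‖f' ω φ - f' ω ψ‖ ≤ l * b ω ^ 2 * ‖φ - ψ‖

variable {Φ : Set V} {x f : Ω → V → E} {x' f' : Ω → V → V →L[ℝ] E} {b : Ω → ℝ} {l : ℝ}

theorem SmoothFamily.point_sub_le (h : SmoothFamily Φ x f x' f' b l) (hΦ : Convex ℝ Φ) (ω : Ω)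
    {φ ψ : V} (hφ : φ ∈ Φ) (hψ : ψ ∈ Φ) : ‖x ω φ - x ω ψ‖ ≤ b ω * ‖φ - ψ‖ :=
  hΦ.norm_image_sub_le_of_norm_hasFDerivWithin_le
    (fun w hw => (h.hasFDerivAt_point ω w hw).hasFDerivWithinAt) (h.point_le ω) hψ hφ

theorem SmoothFamily.vector_sub_le (h : SmoothFamily Φ x f x' f' b l) (hΦ : Convex ℝ Φ) (ω : Ω)
    {φ ψ : V} (hφ : φ ∈ Φ) (hψ : ψ ∈ Φ) : ‖f ω φ - f ω ψ‖ ≤ l * b ω * ‖φ - ψ‖ :=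
  hΦ.norm_image_sub_le_of_norm_hasFDerivWithin_le
    (fun w hw => (h.hasFDerivAt_vector ω w hw).hasFDerivWithinAt) (h.vector_le ω) hψ hφ

/-- The interaction `k(x,x')⟨f,f'⟩` of two sample points. -/
def interaction (k : E → E → ℝ) (x f : Ω → V → E) (p : Ω × Ω) (φ : V) : ℝ :=
  k (x p.1 φ) (x p.2 φ) * inner ℝ (f p.1 φ) (f p.2 φ)

/-- The part of the derivative of the interaction that comes from the first sample point. -/
def interactionFst (k : E → E → ℝ) (k₁ : E → E → E →L[ℝ] ℝ) (x f : Ω → V → E)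
    (x' f' : Ω → V → V →L[ℝ] E) (p : Ω × Ω) (φ : V) : V →L[ℝ] ℝ :=
  inner ℝ (f p.1 φ) (f p.2 φ) • (k₁ (x p.1 φ) (x p.2 φ)).comp (x' p.1 φ) +
    k (x p.1 φ) (x p.2 φ) • (innerSL ℝ (f p.2 φ)).comp (f' p.1 φ)

variable {k : E → E → ℝ} {k₁ : E → E → E →L[ℝ] ℝ} {K : ℝ}

/-- Because `k` and the inner product are symmetric, the second sample point contributes the same
expression as the first with the pair swapped. Only `interactionFst` has to be estimated from here
on. -/
theorem SmoothFamily.hasFDerivAt_interaction (hk : SmoothKernel k k₁ K)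
    (h : SmoothFamily Φ x f x' f' b l) (p : Ω × Ω) {φ : V} (hφ : φ ∈ Φ) :
    HasFDerivAt (interaction k x f p)
      (interactionFst k k₁ x f x' f' p φ + interactionFst k k₁ x f x' f' p.swap φ) φ := by
  have h1 := HasFDerivAt.comp φ (hk.hasFDerivAt (x p.1 φ) (x p.2 φ))
    ((h.hasFDerivAt_point p.1 φ hφ).prodMk (h.hasFDerivAt_point p.2 φ hφ))
  have h2 := (h.hasFDerivAt_vector p.1 φ hφ).inner ℝ (h.hasFDerivAt_vector p.2 φ hφ)
  refine (h1.mul h2).congr_fderiv ?_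
  ext v
  simp only [interactionFst, Function.comp, Function.uncurry, Prod.fst_swap, Prod.snd_swap]
  simp only [add_apply, smul_apply, smul_eq_mul,
    ContinuousLinearMap.comp_apply, ContinuousLinearMap.prod_apply, fderivInnerCLM_apply,
    ContinuousLinearMap.coprod_apply, innerSL_apply_apply]
  rw [hk.symm (x p.2 φ) (x p.1 φ), real_inner_comm (f p.1 φ) (f p.2 φ),
    real_inner_comm (f p.2 φ) (f' p.1 φ v)]
  ring

/-- Requiring `l ≤ T` lets the term with the derivative of `f`, of size `l b`, be absorbed into the
same bound as the term with the derivative of `k`. -/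
theorem norm_interactionFst_le (hk : SmoothKernel k k₁ K)
    (h : SmoothFamily Φ x f x' f' b l) (p : Ω × Ω) {φ : V} (hφ : φ ∈ Φ) {T T' : ℝ}
    (hT : ‖f p.1 φ‖ ≤ T) (hT' : ‖f p.2 φ‖ ≤ T') (hl : l ≤ T) :
    ‖interactionFst k k₁ x f x' f' p φ‖ ≤ 2 * K * b p.1 * T * T' := by
  have hK := hk.nonneg
  have hb := h.one_le p.1
  have hl0 := h.nonneg
  have hT'0 := (norm_nonneg _).trans hT'
  have h1 := norm_smul_comp_le (abs_inner_le hT hT') (hk.norm_le (x p.1 φ) (x p.2 φ))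
    (h.point_le p.1 φ hφ)
  have h2 := norm_smul_comp_le (hk.abs_le (x p.1 φ) (x p.2 φ))
    ((innerSL_apply_norm ℝ (f p.2 φ)).trans_le hT') ((h.vector_le p.1 φ hφ).trans
    (by gcongr : l * b p.1 ≤ T * b p.1))
  refine (norm_add_le _ _).trans ((add_le_add h1 h2).trans (le_of_eq (by ring)))

/-- Telescoping: each of the seven terms changes a single factor from ψ to φ, and so carries one
Lipschitz increment. -/
theorem interactionFst_sub (p : Ω × Ω) (φ ψ : V) :
    interactionFst k k₁ x f x' f' p φ - interactionFst k k₁ x f x' f' p ψ =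
      inner ℝ (f p.1 φ) (f p.2 φ) •
        (k₁ (x p.1 φ) (x p.2 φ) - k₁ (x p.1 ψ) (x p.2 ψ)).comp (x' p.1 φ) +
      inner ℝ (f p.1 φ) (f p.2 φ) •
        (k₁ (x p.1 ψ) (x p.2 ψ)).comp (x' p.1 φ - x' p.1 ψ) +
      inner ℝ (f p.1 φ - f p.1 ψ) (f p.2 φ) • (k₁ (x p.1 ψ) (x p.2 ψ)).comp (x' p.1 ψ) +
      inner ℝ (f p.1 ψ) (f p.2 φ - f p.2 ψ) • (k₁ (x p.1 ψ) (x p.2 ψ)).comp (x' p.1 ψ) +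
      (k (x p.1 φ) (x p.2 φ) - k (x p.1 ψ) (x p.2 ψ)) •
        (innerSL ℝ (f p.2 φ)).comp (f' p.1 φ) +
      k (x p.1 ψ) (x p.2 ψ) • (innerSL ℝ (f p.2 φ)).comp (f' p.1 φ - f' p.1 ψ) +
      k (x p.1 ψ) (x p.2 ψ) • (innerSL ℝ (f p.2 φ - f p.2 ψ)).comp (f' p.1 ψ) := by
    ext v
    simp only [interactionFst, add_apply, sub_apply,
      smul_apply, smul_eq_mul, ContinuousLinearMap.comp_apply, map_sub,
      innerSL_apply_apply, inner_sub_left, inner_sub_right]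
    ring

theorem norm_interactionFst_sub_le (hk : SmoothKernel k k₁ K)
    (h : SmoothFamily Φ x f x' f' b l) (hΦ : Convex ℝ Φ) (p : Ω × Ω) {φ ψ : V} (hφ : φ ∈ Φ)
    (hψ : ψ ∈ Φ) {T T' : ℝ} (hT : ‖f p.1 φ‖ + ‖f p.1 ψ‖ + l ≤ T)
    (hT' : ‖f p.2 φ‖ + ‖f p.2 ψ‖ + l ≤ T') :
    ‖interactionFst k k₁ x f x' f' p φ - interactionFst k k₁ x f x' f' p ψ‖ ≤
      K * (7 * b p.1 ^ 2 + 2 * b p.2 ^ 2) * T * T' * ‖φ - ψ‖ := by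
  have hK := hk.nonneg
  have hb := h.one_le p.1
  have hb' := h.one_le p.2
  have hl0 := h.nonneg
  have hfφ := norm_nonneg (f p.1 φ)
  have hfψ := norm_nonneg (f p.1 ψ)
  have hfφ' := norm_nonneg (f p.2 φ)
  have hfψ' := norm_nonneg (f p.2 ψ)
  have hT0 : 0 ≤ T := by linarith
  have hT0' : 0 ≤ T' := by linarith
  have hlT : l ≤ T := by linarith
  have hlT' : l ≤ T' := by linarith
  have hD := norm_nonneg (φ - ψ)
  have hx := h.point_sub_le hΦ p.1 hφ hψ
  have hx' := h.point_sub_le hΦ p.2 hφ hψ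
  have hf := h.vector_sub_le hΦ p.1 hφ hψ
  have hf' := h.vector_sub_le hΦ p.2 hφ hψ
  have hk₁ : ‖k₁ (x p.1 φ) (x p.2 φ) - k₁ (x p.1 ψ) (x p.2 ψ)‖ ≤
      K * ((b p.1 + b p.2) * ‖φ - ψ‖) :=
    (hk.lipschitz _ _ _ _).trans (by rw [add_mul]; gcongr)
  have hk₀ : ‖k (x p.1 φ) (x p.2 φ) - k (x p.1 ψ) (x p.2 ψ)‖ ≤
      K * ((b p.1 + b p.2) * ‖φ - ψ‖) :=
    (hk.abs_sub_le _ _ _ _).trans (by rw [add_mul]; gcongr)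
  have a1 := (hk.norm_le (x p.1 ψ) (x p.2 ψ))
  have a2 := hk.abs_le (x p.1 ψ) (x p.2 ψ)
  rw [interactionFst_sub]
  set D := ‖φ - ψ‖
  have g₁ : ‖f p.1 φ‖ ≤ T := by linarith
  have g₂ : ‖f p.2 φ‖ ≤ T' := by linarith
  have g₃ : ‖f p.1 ψ‖ ≤ T := by linarith
  have d₁ : ‖f p.1 φ - f p.1 ψ‖ ≤ T * b p.1 * D := hf.trans (by gcongr)
  have d₂ : ‖f p.2 φ - f p.2 ψ‖ ≤ T' * b p.2 * D := hf'.trans (by gcongr)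
  have t1 := norm_smul_comp_le (abs_inner_le g₁ g₂) hk₁ (h.point_le p.1 φ hφ)
  have t2 := norm_smul_comp_le (abs_inner_le g₁ g₂) a1 (h.point_lip p.1 φ hφ ψ hψ)
  have t3 := norm_smul_comp_le (abs_inner_le d₁ g₂) a1 (h.point_le p.1 ψ hψ)
  have t4 := norm_smul_comp_le (abs_inner_le g₃ d₂) a1 (h.point_le p.1 ψ hψ)
  have i1 : ‖innerSL ℝ (f p.2 φ)‖ ≤ T' := by rw [innerSL_apply_norm]; linarith
  have i2 : ‖innerSL ℝ (f p.2 φ - f p.2 ψ)‖ ≤ T' * b p.2 * D := by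
    rw [innerSL_apply_norm]; exact hf'.trans (by gcongr)
  have t5 := norm_smul_comp_le hk₀ i1 ((h.vector_le p.1 φ hφ).trans
    (by gcongr : l * b p.1 ≤ T * b p.1))
  have t6 := norm_smul_comp_le a2 i1 ((h.vector_lip p.1 φ hφ ψ hψ).trans
    (by gcongr : l * b p.1 ^ 2 * D ≤ T * b p.1 ^ 2 * D))
  have t7 := norm_smul_comp_le a2 i2 ((h.vector_le p.1 ψ hψ).trans
    (by gcongr : l * b p.1 ≤ T * b p.1))
  refine ((norm_add_le_of_le (norm_add_le_of_le (norm_add_le_of_le (norm_add_le_of_le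
    (norm_add_le_of_le (norm_add_le_of_le t1 t2) t3) t4) t5) t6) t7)).trans ?_
  have hW : 0 ≤ K * T * T' * D := by positivity
  -- The left side is 4b² + b + 4bb', one contribution from each of the seven terms; b ≤ b² as b ≥
  -- 1, and 4bb' ≤ 2b² + 2b'².
  have hpoly : (b p.1 + b p.2) * b p.1 + b p.1 + b p.1 ^ 2 + b p.1 * b p.2 +
      (b p.1 + b p.2) * b p.1 + b p.1 ^ 2 + b p.1 * b p.2 ≤ 7 * b p.1 ^ 2 + 2 * b p.2 ^ 2 := by
    nlinarith [sq_nonneg (b p.1 - b p.2)]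
  refine le_trans (le_of_eq ?_) ((mul_le_mul_of_nonneg_left hpoly hW).trans (le_of_eq ?_)) <;> ring

end Energy

/-! ### Differentiating the energy integral and bounding its gradient's variation -/

section Energy

open Filter Topology

theorem integral_mul_le_of_integral_sq_le {Ω : Type*} [MeasurableSpace Ω] {P : Measure Ω}
    {g h : Ω → ℝ} (hg : MemLp g 2 P) (hh : MemLp h 2 P) (hg0 : ∀ ω, 0 ≤ g ω) (hh0 : ∀ ω, 0 ≤ h ω)
    {β τ : ℝ} (hβ : 0 ≤ β) (hτ : 0 ≤ τ) (hgβ : ∫ ω, g ω ^ 2 ∂P ≤ β ^ 2)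
    (hhτ : ∫ ω, h ω ^ 2 ∂P ≤ τ ^ 2) : ∫ ω, g ω * h ω ∂P ≤ β * τ := by
  have h2 : ENNReal.ofReal 2 = 2 := by norm_num
  have := integral_mul_le_Lp_mul_Lq_of_nonneg (μ := P) (p := 2) (q := 2)
    (by constructor <;> norm_num) (ae_of_all _ hg0) (ae_of_all _ hh0) (by rwa [h2]) (by rwa [h2])
  refine this.trans ?_
  simp only [Real.rpow_ofNat, ← Real.sqrt_eq_rpow]
  gcongr
  exacts [Real.sqrt_le_iff.2 ⟨hβ, hgβ⟩, Real.sqrt_le_iff.2 ⟨hτ, hhτ⟩]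

variable {d m : ℕ} {Ω : Type*} [MeasurableSpace Ω] {P : Measure Ω} [IsProbabilityMeasure P]
  {Φ : Set (EuclideanSpace ℝ (Fin m))}
  {x f : Ω → EuclideanSpace ℝ (Fin m) → EuclideanSpace ℝ (Fin d)}
  {x' f' : Ω → EuclideanSpace ℝ (Fin m) → EuclideanSpace ℝ (Fin m) →L[ℝ] EuclideanSpace ℝ (Fin d)}
  {b : Ω → ℝ} {l K : ℝ} {k : EuclideanSpace ℝ (Fin d) → EuclideanSpace ℝ (Fin d) → ℝ}
  {k₁ : EuclideanSpace ℝ (Fin d) → EuclideanSpace ℝ (Fin d) → EuclideanSpace ℝ (Fin d) →L[ℝ] ℝ}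

theorem SmoothKernel.continuous (hk : SmoothKernel k k₁ K) : Continuous (Function.uncurry k) :=
  continuous_iff_continuousAt.2 fun p => (hk.hasFDerivAt p.1 p.2).continuousAt

theorem measurable_interaction (hk : SmoothKernel k k₁ K) {φ : EuclideanSpace ℝ (Fin m)}
    (hx : Measurable fun ω => x ω φ) (hf : Measurable fun ω => f ω φ) :
    Measurable fun p : Ω × Ω => interaction k x f p φ := by
  refine Measurable.mul ?_ ?_
  · exact hk.continuous.measurable.comp
      ((hx.comp measurable_fst).prodMk (hx.comp measurable_snd))
  · exact (hf.comp measurable_fst).inner (hf.comp measurable_snd)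

theorem integrable_interaction (hk : SmoothKernel k k₁ K) {φ : EuclideanSpace ℝ (Fin m)}
    (hx : Measurable fun ω => x ω φ) (hf : Measurable fun ω => f ω φ)
    (hf2 : MemLp (fun ω => f ω φ) 2 P) :
    Integrable (fun p : Ω × Ω => interaction k x f p φ) (P.prod P) := by
  have hi : Integrable (fun ω => ‖f ω φ‖) P := (hf2.integrable (by norm_num)).norm
  refine ((hi.mul_prod hi).const_mul K).mono' (measurable_interaction hk hx hf).aestronglyMeasurable
    (ae_of_all _ fun p => ?_)
  rw [interaction, norm_mul]
  have := hk.nonneg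
  exact mul_le_mul (hk.abs_le _ _) (norm_inner_le_norm _ _) (norm_nonneg _) this

/-- Dominated differentiation. The dominating function is a sum of products of functions of one
sample each, hence integrable on the product space once `b` and `f` are square integrable. -/
theorem hasFDerivAt_integral_interaction (hk : SmoothKernel k k₁ K)
    (h : SmoothFamily Φ x f x' f' b l) (hΦo : IsOpen Φ) (hΦ : Convex ℝ Φ)
    (hx : ∀ φ ∈ Φ, Measurable fun ω => x ω φ) (hf : ∀ φ ∈ Φ, Measurable fun ω => f ω φ)
    (hb : Measurable b) (hb2 : MemLp (fun ω => b ω ^ 2) 2 P)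
    (hf2 : ∀ φ ∈ Φ, MemLp (fun ω => f ω φ) 2 P) {φ : EuclideanSpace ℝ (Fin m)} (hφ : φ ∈ Φ) :
    Integrable (fun p => interactionFst k k₁ x f x' f' p φ +
      interactionFst k k₁ x f x' f' p.swap φ) (P.prod P) ∧
    HasFDerivAt (fun ψ => ∫ p, interaction k x f p ψ ∂(P.prod P))
      (∫ p, interactionFst k k₁ x f x' f' p φ + interactionFst k k₁ x f x' f' p.swap φ
        ∂(P.prod P)) φ := by
  have hK := hk.nonneg
  have hl := h.nonneg
  have hb0 : ∀ ω, 0 ≤ b ω := fun ω => zero_le_one.trans (h.one_le ω)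
  have hbL : MemLp b 2 P := hb2.mono hb.aestronglyMeasurable (ae_of_all _ fun ω => by
    rw [Real.norm_of_nonneg (hb0 ω), Real.norm_of_nonneg (by positivity)]
    nlinarith [h.one_le ω])
  -- On the unit ball around φ the vector `f` moves by at most `l b`, so `T` dominates it there; the
  -- last summand ensures `l ≤ T`.
  set T : Ω → ℝ := fun ω => ‖f ω φ‖ + l * b ω + l with hTdef
  have hTL : MemLp T 2 P := ((hf2 φ hφ).norm.add (hbL.const_mul l)).add (memLp_const l)
  have hTi : Integrable T P := hTL.integrable (by norm_num)
  have hbT : Integrable (fun ω => b ω * T ω) P := hbL.integrable_mul hTL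
  have hs : Φ ∩ Metric.ball φ 1 ∈ 𝓝 φ :=
    inter_mem (hΦo.mem_nhds hφ) (Metric.ball_mem_nhds _ one_pos)
  have hmeas : ∀ᶠ ψ in 𝓝 φ, AEStronglyMeasurable (fun p => interaction k x f p ψ) (P.prod P) := by
    filter_upwards [hΦo.mem_nhds hφ] with ψ hψ
    exact (measurable_interaction hk (hx ψ hψ) (hf ψ hψ)).aestronglyMeasurable
  have hT : ∀ ω, ∀ ψ ∈ Φ ∩ Metric.ball φ 1, ‖f ω ψ‖ ≤ T ω := by
    intro ω ψ hψ
    have h1 := h.vector_sub_le hΦ ω hψ.1 hφ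
    have h2 : ‖ψ - φ‖ ≤ 1 := by simpa [dist_eq_norm] using hψ.2.le
    have h3 := norm_sub_norm_le (f ω ψ) (f ω φ)
    have h4 : l * b ω * ‖ψ - φ‖ ≤ l * b ω * 1 := by have := hb0 ω; gcongr
    simp only [hTdef]
    linarith
  have hlT : ∀ ω, l ≤ T ω := fun ω => by
    have := mul_nonneg hl (hb0 ω)
    have := norm_nonneg (f ω φ)
    simp only [hTdef]
    linarith
  set bound : Ω × Ω → ℝ := fun p =>
    2 * K * (b p.1 * T p.1 * T p.2) + 2 * K * (T p.1 * (b p.2 * T p.2))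
  have hbound : Integrable bound (P.prod P) :=
    ((hbT.mul_prod hTi).const_mul _).add ((hTi.mul_prod hbT).const_mul _)
  have hle : ∀ p : Ω × Ω, ∀ ψ ∈ Φ ∩ Metric.ball φ 1, ‖interactionFst k k₁ x f x' f' p ψ +
      interactionFst k k₁ x f x' f' p.swap ψ‖ ≤ bound p := by
    intro p ψ hψ
    refine (norm_add_le_of_le (norm_interactionFst_le hk h p hψ.1 (hT _ _ hψ) (hT _ _ hψ) (hlT _))
      (norm_interactionFst_le hk h p.swap hψ.1 (hT _ _ hψ) (hT _ _ hψ) (hlT _))).trans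
      (le_of_eq ?_)
    simp only [bound, Prod.fst_swap, Prod.snd_swap]
    ring
  have hmeas' : AEStronglyMeasurable (fun p => interactionFst k k₁ x f x' f' p φ +
      interactionFst k k₁ x f x' f' p.swap φ) (P.prod P) :=
    aestronglyMeasurable_of_hasFDerivAt (F := fun ψ p => interaction k x f p ψ) hmeas
      fun p => h.hasFDerivAt_interaction hk p hφ
  refine ⟨hbound.mono' hmeas' (ae_of_all _ fun p => hle p φ (mem_of_mem_nhds hs)), ?_⟩
  exact hasFDerivAt_integral_of_dominated_of_fderiv_le (F := fun ψ p => interaction k x f p ψ)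
    (F' := fun ψ p => interactionFst k k₁ x f x' f' p ψ +
      interactionFst k k₁ x f x' f' p.swap ψ) hs hmeas
    (integrable_interaction hk (hx φ hφ) (hf φ hφ) (hf2 φ hφ)) hmeas'
    (ae_of_all _ hle) hbound (ae_of_all _ fun p ψ hψ => h.hasFDerivAt_interaction hk p hψ.1)

/-- The two halves of the derivative add up to the weight 9(b² + b'²), since 7 + 2 = 9. By
independence each of the two resulting terms integrates to E[b²T] · E[T], and Cauchy–Schwarz bounds
this by βτ · τ; hence the factor 18. -/
theorem isSmoothOn_integral_interaction (hk : SmoothKernel k k₁ K)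
    (h : SmoothFamily Φ x f x' f' b l) (hΦo : IsOpen Φ) (hΦ : Convex ℝ Φ)
    (hx : ∀ φ ∈ Φ, Measurable fun ω => x ω φ) (hf : ∀ φ ∈ Φ, Measurable fun ω => f ω φ)
    (hb : Measurable b) (hb2 : MemLp (fun ω => b ω ^ 2) 2 P)
    (hf2 : ∀ φ ∈ Φ, MemLp (fun ω => f ω φ) 2 P) {β τ : ℝ} (hβ : 0 ≤ β) (hτ : 0 ≤ τ)
    (hbβ : ∫ ω, (b ω ^ 2) ^ 2 ∂P ≤ β ^ 2)
    (hfτ : ∀ φ ∈ Φ, ∀ ψ ∈ Φ, ∫ ω, (‖f ω φ‖ + ‖f ω ψ‖ + l) ^ 2 ∂P ≤ τ ^ 2) :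
    IsSmoothOn (18 * K * β * τ ^ 2) (fun φ => ∫ p, interaction k x f p φ ∂(P.prod P)) Φ := by
  have hD := fun φ hφ => hasFDerivAt_integral_interaction (φ := φ) hk h hΦo hΦ hx hf hb hb2 hf2 hφ
  refine ⟨fun φ hφ => (hD φ hφ).2.differentiableAt, fun φ hφ ψ hψ => ?_⟩
  have hK := hk.nonneg
  have hl := h.nonneg
  rw [gradient, gradient, ← map_sub, LinearIsometryEquiv.norm_map, (hD φ hφ).2.fderiv,
    (hD ψ hψ).2.fderiv, ← integral_sub (hD φ hφ).1 (hD ψ hψ).1]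
  set T : Ω → ℝ := fun ω => ‖f ω φ‖ + ‖f ω ψ‖ + l with hTdef
  have hT0 : ∀ ω, 0 ≤ T ω := fun ω => by positivity
  have hTL : MemLp T 2 P := ((hf2 φ hφ).norm.add (hf2 ψ hψ).norm).add (memLp_const l)
  have hTi : Integrable T P := hTL.integrable (by norm_num)
  have hbT : Integrable (fun ω => b ω ^ 2 * T ω) P := hb2.integrable_mul hTL
  have e1 : ∫ ω, b ω ^ 2 * T ω ∂P ≤ β * τ :=
    integral_mul_le_of_integral_sq_le hb2 hTL (fun ω => by positivity) hT0 hβ hτ hbβ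
      (hfτ φ hφ ψ hψ)
  have e2 : ∫ ω, T ω ∂P ≤ τ := by
    simpa using integral_mul_le_of_integral_sq_le (g := fun _ => 1) (memLp_const (1 : ℝ)) hTL
      (fun ω => zero_le_one) hT0 zero_le_one hτ (by simp) (hfτ φ hφ ψ hψ)
  have e3 : 0 ≤ ∫ ω, b ω ^ 2 * T ω ∂P :=
    integral_nonneg fun ω => mul_nonneg (sq_nonneg _) (hT0 ω)
  have e4 : 0 ≤ ∫ ω, T ω ∂P := integral_nonneg hT0
  set bound : Ω × Ω → ℝ := fun p =>
    9 * K * ‖φ - ψ‖ * (b p.1 ^ 2 * T p.1 * T p.2 + T p.1 * (b p.2 ^ 2 * T p.2))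
  have hbound : Integrable bound (P.prod P) :=
    ((hbT.mul_prod hTi).add (hTi.mul_prod hbT)).const_mul _
  refine (norm_integral_le_of_norm_le hbound (ae_of_all _ fun p => ?_)).trans ?_
  · rw [add_sub_add_comm]
    refine (norm_add_le_of_le
      (norm_interactionFst_sub_le hk h hΦ p hφ hψ (T := T p.1) (T' := T p.2) le_rfl le_rfl)
      (norm_interactionFst_sub_le hk h hΦ p.swap hφ hψ (T := T p.2) (T' := T p.1) le_rfl
        le_rfl)).trans (le_of_eq ?_)
    simp only [bound, Prod.fst_swap, Prod.snd_swap]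
    ring
  · have : ∫ p, bound p ∂(P.prod P) =
        9 * K * ‖φ - ψ‖ * (2 * ((∫ ω, b ω ^ 2 * T ω ∂P) * ∫ ω, T ω ∂P)) := by
      simp only [bound]
      rw [integral_const_mul, integral_add (hbT.mul_prod hTi) (hTi.mul_prod hbT),
        integral_prod_mul (μ := P) (ν := P) (fun ω => b ω ^ 2 * T ω) T,
        integral_prod_mul (μ := P) (ν := P) T (fun ω => b ω ^ 2 * T ω)]
      ring
    rw [this]
    calc _ ≤ 9 * K * ‖φ - ψ‖ * (2 * (β * τ * τ)) := by gcongr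
      _ = _ := by ring

end Energy

/-! ### Kernels of reproducing kernel Hilbert spaces -/

section RKHSKernel

variable {d : ℕ} (H : Type*) [NormedAddCommGroup H] [InnerProductSpace ℝ H]
  [CompleteSpace H] [RKHS ℝ H (EuclideanSpace ℝ (Fin d)) ℝ]
  {k : EuclideanSpace ℝ (Fin d) → EuclideanSpace ℝ (Fin d) → ℝ}

theorem inner_kerFun_kerFun (hk : ∀ x y, RKHS.kernel H x y (1 : ℝ) = k x y)
    (x y : EuclideanSpace ℝ (Fin d)) :
    inner ℝ (RKHS.kerFun H x (1 : ℝ)) (RKHS.kerFun H y (1 : ℝ)) = k x y := by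
  rw [RKHS.kerFun_inner, RKHS.kerFun_apply, hk]
  simp

theorem kernel_symm (hk : ∀ x y, RKHS.kernel H x y (1 : ℝ) = k x y)
    (x y : EuclideanSpace ℝ (Fin d)) : k x y = k y x := by
  rw [← inner_kerFun_kerFun H hk, real_inner_comm, inner_kerFun_kerFun H hk]

theorem norm_kerFun_sq (hk : ∀ x y, RKHS.kernel H x y (1 : ℝ) = k x y)
    (x : EuclideanSpace ℝ (Fin d)) : ‖RKHS.kerFun H x (1 : ℝ)‖ ^ 2 = k x x := by
  rw [← inner_kerFun_kerFun H hk, real_inner_self_eq_norm_sq]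

theorem norm_kerFun_le (hk : ∀ x y, RKHS.kernel H x y (1 : ℝ) = k x y) {B : ℝ}
    (hB : 0 ≤ B) (hkB : ∀ x y, k x y ≤ B ^ 2)
    (x : EuclideanSpace ℝ (Fin d)) : ‖RKHS.kerFun H x (1 : ℝ)‖ ≤ B := by
  rw [← sq_le_sq₀ (norm_nonneg _) hB, norm_kerFun_sq H hk]
  exact hkB x x

/-- The squared distance of two feature vectors is k(y,y) - 2k(y,x) + k(x,x), which tends to 0 by
continuity of `k`. This makes the `H`-valued integrands measurable. -/
theorem continuous_kerFun (hk : ∀ x y, RKHS.kernel H x y (1 : ℝ) = k x y)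
    (hc : Continuous (Function.uncurry k)) :
    Continuous fun x : EuclideanSpace ℝ (Fin d) => RKHS.kerFun H x (1 : ℝ) := by
  rw [continuous_iff_continuousAt]
  intro x
  rw [ContinuousAt, tendsto_iff_norm_sub_tendsto_zero]
  have h : ∀ y, ‖RKHS.kerFun H y (1 : ℝ) - RKHS.kerFun H x (1 : ℝ)‖ =
      √(k y y - 2 * k y x + k x x) := by
    intro y
    rw [← norm_kerFun_sq H hk, ← norm_kerFun_sq H hk, ← inner_kerFun_kerFun H hk,
      ← norm_sub_sq_real, Real.sqrt_sq (norm_nonneg _)]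
  simp only [h]
  have h1 : Continuous fun y => k y y := hc.comp (continuous_id.prodMk continuous_id)
  have h2 : Continuous fun y => k y x := hc.comp (continuous_id.prodMk continuous_const)
  have h3 : Continuous fun y => √(k y y - 2 * k y x + k x x) := by fun_prop
  have := h3.tendsto x
  simpa [show k x x - 2 * k x x + k x x = 0 by ring] using this

/-- Only an upper bound on `k` is assumed; the bound on |k| comes from Cauchy–Schwarz in `H`, where
k(x,x) is the squared norm of a feature vector. The two second-order bounds give the Lipschitz
property one variable at a time. -/
theorem BoundedKernel.smoothKernel (hk : ∀ x y, RKHS.kernel H x y (1 : ℝ) = k x y) {B : ℝ}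
    (hB : 0 ≤ B) (h : BoundedKernel k B) :
    SmoothKernel k (fun x y => fderiv ℝ (fun x' => k x' y) x) (B ^ 2) := by
  have hsymm := kernel_symm H hk
  have h1 : ∀ x y, fderiv ℝ (fun x' => k x' y) x =
      (fderiv ℝ (Function.uncurry k) (x, y)).comp (ContinuousLinearMap.inl ℝ _ _) := by
    intro x y
    have h2 : HasFDerivAt (fun w : EuclideanSpace ℝ (Fin d) => (w, y))
        (ContinuousLinearMap.inl ℝ _ _) x := hasFDerivAt_prodMk_left x y
    exact (HasFDerivAt.comp x (h.differentiable (x, y)).hasFDerivAt h2).fderiv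
  have h2 : ∀ x y, fderiv ℝ (fun x' => k x' x) y =
      (fderiv ℝ (Function.uncurry k) (x, y)).comp (ContinuousLinearMap.inr ℝ _ _) := by
    intro x y
    have h3 : HasFDerivAt (fun w : EuclideanSpace ℝ (Fin d) => (x, w))
        (ContinuousLinearMap.inr ℝ _ _) y := hasFDerivAt_prodMk_right x y
    rw [← (HasFDerivAt.comp y (h.differentiable (x, y)).hasFDerivAt h3).fderiv]
    congr 1
    funext w
    exact hsymm w x
  have hdiff : Differentiable ℝ fun p : EuclideanSpace ℝ (Fin d) × EuclideanSpace ℝ (Fin d) =>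
      fderiv ℝ (fun x' => k x' p.2) p.1 := by
    simp only [h1]
    exact h.differentiable_fderiv.clm_comp (differentiable_const _)
  refine ⟨hsymm, fun x y => ?_, fun x y => ?_, h.bound_one, fun x y x' y' => ?_⟩
  · refine (h.differentiable (x, y)).hasFDerivAt.congr_fderiv ?_
    rw [h1, h2]
    ext p <;> simp
  · rw [← inner_kerFun_kerFun H hk, sq]
    exact abs_inner_le (norm_kerFun_le H hk hB h.bound x) (norm_kerFun_le H hk hB h.bound y)
  · have e1 : ‖fderiv ℝ (fun w => k w y) x - fderiv ℝ (fun w => k w y) x'‖ ≤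
        B ^ 2 * ‖x - x'‖ :=
      convex_univ.norm_image_sub_le_of_norm_fderiv_le (𝕜 := ℝ)
        (f := fun x => fderiv ℝ (fun w => k w y) x)
        (fun w _ => (hdiff.comp (differentiable_id.prodMk (differentiable_const y))) w)
        (fun w _ => h.bound_one_one w y) (Set.mem_univ _) (Set.mem_univ _)
    have e2 : ‖fderiv ℝ (fun w => k w y) x' - fderiv ℝ (fun w => k w y') x'‖ ≤
        B ^ 2 * ‖y - y'‖ :=
      convex_univ.norm_image_sub_le_of_norm_fderiv_le (𝕜 := ℝ)
        (f := fun y => fderiv ℝ (fun w => k w y) x')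
        (fun w _ => (hdiff.comp ((differentiable_const x').prodMk differentiable_id)) w)
        (fun w _ => h.bound_one_two x' w) (Set.mem_univ _) (Set.mem_univ _)
    calc _ ≤ _ := norm_sub_le_norm_sub_add_norm_sub _ (fderiv ℝ (fun w => k w y) x') _
      _ ≤ _ := by linarith

end RKHSKernel

/-! ### Diagonal Gaussians and their mixtures -/

section Gaussian

variable {d : ℕ}

/-- Coordinatewise multiplication by `ξ`. -/
def diagMul (ξ : Fin d → ℝ) : EuclideanSpace ℝ (Fin d) →L[ℝ] EuclideanSpace ℝ (Fin d) :=
  LinearMap.toContinuousLinearMap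
    { toFun := fun v => WithLp.toLp 2 fun i => ξ i * v i
      map_add' := fun v w => by ext i; simp [mul_add]
      map_smul' := fun c v => by ext i; simp [mul_left_comm] }

@[simp]
theorem diagMul_apply (ξ : Fin d → ℝ) (v : EuclideanSpace ℝ (Fin d)) (i : Fin d) :
    diagMul ξ v i = ξ i * v i := rfl

/-- A diagonal operator is controlled by its largest entry, not by the Euclidean norm of ξ. This is
why the noise costs log d rather than d in the envelope. -/
theorem norm_diagMul_le {ξ : Fin d → ℝ} {c : ℝ} (hc : 0 ≤ c) (h : ∀ i, |ξ i| ≤ c) :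
    ‖diagMul ξ‖ ≤ c := by
  refine ContinuousLinearMap.opNorm_le_bound _ hc fun v => ?_
  rw [← sq_le_sq₀ (norm_nonneg _) (by positivity), mul_pow, EuclideanSpace.norm_sq_eq,
    EuclideanSpace.norm_sq_eq, Finset.mul_sum]
  refine Finset.sum_le_sum fun i _ => ?_
  rw [diagMul_apply, norm_mul, mul_pow]
  gcongr
  exact h i

/-- The standard Gaussian measure on the product space. -/
def stdNormal (d : ℕ) : Measure (Fin d → ℝ) := Measure.pi fun _ => gaussianReal 0 1

instance : IsProbabilityMeasure (stdNormal d) := by unfold stdNormal; infer_instance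

theorem pi_gaussianReal_eq_withDensity (m : Fin d → ℝ) {v : Fin d → ℝ≥0} (hv : ∀ i, v i ≠ 0) :
    Measure.pi (fun i => gaussianReal (m i) (v i)) =
      volume.withDensity fun x => ENNReal.ofReal (∏ i, gaussianPDFReal (m i) (v i) (x i)) := by
  refine Measure.pi_eq fun t ht => ?_
  rw [withDensity_apply _ (MeasurableSet.univ_pi ht), volume_pi, Measure.restrict_pi_pi,
    ← ofReal_integral_eq_lintegral_ofReal, integral_fintype_prod_eq_prod
      (fun i x => gaussianPDFReal (m i) (v i) x), ENNReal.ofReal_prod_of_nonneg]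
  · exact Finset.prod_congr rfl fun i _ => (gaussianReal_apply_eq_integral _ (hv i) _).symm
  · exact fun i _ => integral_nonneg fun x => gaussianPDFReal_nonneg _ _ _
  · exact Integrable.fintype_prod fun i => (integrable_gaussianPDFReal _ _).integrableOn
  · exact ae_of_all _ fun x => Finset.prod_nonneg fun i _ => gaussianPDFReal_nonneg _ _ _

theorem measurable_diagMul {α : Type*} [MeasurableSpace α] {ξ : α → Fin d → ℝ}
    {s : α → EuclideanSpace ℝ (Fin d)} (hξ : Measurable ξ) (hs : Measurable s) :
    Measurable fun a => diagMul (ξ a) (s a) := by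
  have h : Measurable fun a => (fun i => ξ a i * s a i : Fin d → ℝ) :=
    measurable_pi_lambda _ fun i => ((measurable_pi_apply i).comp hξ).mul
      ((EuclideanSpace.proj i : EuclideanSpace ℝ (Fin d) →L[ℝ] ℝ).continuous.measurable.comp hs)
  exact (MeasurableEquiv.toLp 2 (Fin d → ℝ)).measurable.comp h

/-- Reparametrization: an affine map in each coordinate sends the standard Gaussian to the required
one, and products of measures and densities match through the volume preserving identification with
`Fin d → ℝ`. -/
theorem withDensity_diagGaussianDensity (m : EuclideanSpace ℝ (Fin d))
    {s : EuclideanSpace ℝ (Fin d)} (hs : ∀ i, 0 < s i) :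
    volume.withDensity (fun x => ENNReal.ofReal (diagGaussianDensity m s x)) =
      (stdNormal d).map fun ξ => m + diagMul ξ s := by
  have h1 : (fun ξ : Fin d → ℝ => m + diagMul ξ s) =
      (MeasurableEquiv.toLp 2 (Fin d → ℝ)) ∘ fun ξ i => m i + s i * ξ i := by
    funext ξ
    ext i
    simp [mul_comm]
  have h2 : ∀ i, (gaussianReal 0 1).map (fun t => m i + s i * t) =
      gaussianReal (m i) (‖s i‖₊ ^ 2) := by
    intro i
    have : (fun t => m i + s i * t) = (fun t => m i + t) ∘ fun t => s i * t := rfl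
    rw [this, ← Measure.map_map (by fun_prop) (by fun_prop), gaussianReal_map_const_mul,
      gaussianReal_map_const_add]
    congr 1
    · simp
    · ext; simp
  have hm : ∀ i, Measurable fun t : ℝ => m i + s i * t := fun i => by fun_prop
  have h3 : (stdNormal d).map (fun ξ i => m i + s i * ξ i) =
      Measure.pi fun i => gaussianReal (m i) (‖s i‖₊ ^ 2) := by
    have hp : ∀ i, IsProbabilityMeasure ((gaussianReal 0 1).map fun t => m i + s i * t) :=
      fun i => Measure.isProbabilityMeasure_map (hm i).aemeasurable
    rw [stdNormal, Measure.pi_map_pi (f := fun i t => m i + s i * t)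
      fun i => (hm i).aemeasurable]
    simp only [h2]
  rw [h1, ← Measure.map_map (MeasurableEquiv.measurable _)
    (measurable_pi_lambda _ fun i => by fun_prop), h3, pi_gaussianReal_eq_withDensity]
  · ext A hA
    have hpre := (MeasurableEquiv.toLp 2 (Fin d → ℝ)).measurable hA
    rw [withDensity_apply _ hA, Measure.map_apply (MeasurableEquiv.measurable _) hA,
      withDensity_apply _ hpre]
    have hv := PiLp.volume_preserving_toLp (Fin d)
    exact (hv.setLIntegral_comp_preimage_emb
      (MeasurableEquiv.toLp 2 (Fin d → ℝ)).measurableEmbedding _ A).symm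
  · intro i
    have := (hs i).ne'
    simp [this]

/-- The coordinates of the score of a diagonal Gaussian. -/
def gaussianScore (m s x : EuclideanSpace ℝ (Fin d)) (i : Fin d) : ℝ := -((x i - m i) / s i ^ 2)

/-- At a sample the mean cancels and the score is a multiple of the noise alone. Its minus sign is
the reason for the plus sign in `scoreGap`. -/
theorem gaussianScore_add_diagMul (m : EuclideanSpace ℝ (Fin d)) {s : EuclideanSpace ℝ (Fin d)}
    (hs : ∀ i, 0 < s i) (ξ : Fin d → ℝ) (i : Fin d) :
    gaussianScore m s (m + diagMul ξ s) i = -(ξ i / s i) := by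
  have := (hs i).ne'
  simp only [gaussianScore, PiLp.add_apply, diagMul_apply]
  field_simp
  ring

theorem diagGaussianDensity_pos {m s : EuclideanSpace ℝ (Fin d)} (hs : ∀ i, 0 < s i)
    (x : EuclideanSpace ℝ (Fin d)) : 0 < diagGaussianDensity m s x := by
  refine Finset.prod_pos fun i _ => gaussianPDFReal_pos _ _ _ ?_
  have := (hs i).ne'
  simp [this]

theorem diagGaussianDensity_eq (m s x : EuclideanSpace ℝ (Fin d)) :
    diagGaussianDensity m s x =
      (∏ i, (√(2 * Real.pi * s i ^ 2))⁻¹) * Real.exp (-∑ i, (x i - m i) ^ 2 / (2 * s i ^ 2)) := by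
  rw [← Finset.sum_neg_distrib, Real.exp_sum, ← Finset.prod_mul_distrib]
  refine Finset.prod_congr rfl fun i _ => ?_
  simp [gaussianPDFReal, neg_div]

theorem hasFDerivAt_diagGaussianDensity (m s x : EuclideanSpace ℝ (Fin d)) :
    HasFDerivAt (diagGaussianDensity m s) (∑ i,
      (diagGaussianDensity m s x * gaussianScore m s x i) •
      (EuclideanSpace.proj i : EuclideanSpace ℝ (Fin d) →L[ℝ] ℝ)) x := by
  have h1 : HasFDerivAt (fun x : EuclideanSpace ℝ (Fin d) =>
      -∑ i, (x i - m i) ^ 2 / (2 * s i ^ 2)) (∑ i, gaussianScore m s x i •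
      (EuclideanSpace.proj i : EuclideanSpace ℝ (Fin d) →L[ℝ] ℝ)) x := by
    have h2 : ∀ i, HasFDerivAt (fun x : EuclideanSpace ℝ (Fin d) => (x i - m i) ^ 2 / (2 * s i ^ 2))
        (-gaussianScore m s x i •
          (EuclideanSpace.proj i : EuclideanSpace ℝ (Fin d) →L[ℝ] ℝ)) x := by
      intro i
      have h3 : HasFDerivAt (fun x : EuclideanSpace ℝ (Fin d) => x i)
        (EuclideanSpace.proj i : EuclideanSpace ℝ (Fin d) →L[ℝ] ℝ) x :=
        (EuclideanSpace.proj i : EuclideanSpace ℝ (Fin d) →L[ℝ] ℝ).hasFDerivAt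
      have h4 : HasDerivAt (fun t : ℝ => (t - m i) ^ 2 / (2 * s i ^ 2))
          (2 * (x i - m i) / (2 * s i ^ 2)) (x i) := by
        have := (((hasDerivAt_id (x i)).sub_const (m i)).pow 2).div_const (2 * s i ^ 2)
        simpa using this
      refine (h4.comp_hasFDerivAt x h3).congr_fderiv ?_
      rw [gaussianScore, neg_neg, mul_div_mul_left _ _ two_ne_zero]
    refine ((HasFDerivAt.fun_sum fun i _ => h2 i).neg).congr_fderiv ?_
    simp
  have h5 := (h1.exp).const_mul (∏ i, (√(2 * Real.pi * s i ^ 2))⁻¹)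
  have h6 : diagGaussianDensity m s = fun x => (∏ i, (√(2 * Real.pi * s i ^ 2))⁻¹) *
      Real.exp (-∑ i, (x i - m i) ^ 2 / (2 * s i ^ 2)) := funext (diagGaussianDensity_eq m s)
  rw [h6]
  refine h5.congr_fderiv ?_
  rw [smul_smul, Finset.smul_sum]
  simp only [smul_smul]

/-! ### Bounds on Gaussian densities and their scores, uniform in the mean and the point -/

section Bounds

variable {m s : EuclideanSpace ℝ (Fin d)} {L : ℝ}

theorem diagGaussianDensity_le_exp (hL : 0 < L) (hs : ∀ i, 1 / √L ≤ s i)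
    (x : EuclideanSpace ℝ (Fin d)) : diagGaussianDensity m s x ≤
      √L ^ d * Real.exp (-∑ i, (x i - m i) ^ 2 / (2 * s i ^ 2)) := by
  rw [diagGaussianDensity_eq]
  gcongr
  have hL' := Real.sqrt_pos.2 hL
  calc (∏ i, (√(2 * Real.pi * s i ^ 2))⁻¹) ≤ ∏ i : Fin d, √L := by
        refine Finset.prod_le_prod (fun i _ => by positivity) fun i _ => ?_
        have h0 : 0 < s i := (by positivity : 0 < 1 / √L).trans_le (hs i)
        have h1 : s i ≤ √(2 * Real.pi * s i ^ 2) := by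
          refine Real.le_sqrt_of_sq_le ?_
          nlinarith [Real.pi_gt_three, sq_nonneg (s i)]
        calc (√(2 * Real.pi * s i ^ 2))⁻¹ ≤ (s i)⁻¹ := by gcongr
          _ ≤ (1 / √L)⁻¹ := by gcongr; exact hs i
          _ = √L := by simp
    _ = √L ^ d := by simp

theorem diagGaussianDensity_le (hL : 0 < L) (hs : ∀ i, 1 / √L ≤ s i)
    (x : EuclideanSpace ℝ (Fin d)) : diagGaussianDensity m s x ≤ √L ^ d := by
  refine (diagGaussianDensity_le_exp hL hs x).trans (mul_le_of_le_one_right (by positivity) ?_)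
  rw [Real.exp_le_one_iff, neg_nonpos]
  exact Finset.sum_nonneg fun i _ => by positivity

/-- With T the exponent of the Gaussian, the squared score coordinate is at most 2LT, and T exp(-T)
≤ 1. -/
theorem diagGaussianDensity_mul_score_sq_le (hL : 0 < L) (hs : ∀ i, 1 / √L ≤ s i)
    (x : EuclideanSpace ℝ (Fin d)) (i : Fin d) :
    diagGaussianDensity m s x * gaussianScore m s x i ^ 2 ≤ √L ^ d * (2 * L) := by
  have hL' := Real.sqrt_pos.2 hL
  have h0 : 0 < s i := (by positivity : 0 < 1 / √L).trans_le (hs i)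
  have h1 : (s i ^ 2)⁻¹ ≤ L := by
    have : (s i)⁻¹ ≤ √L := (inv_anti₀ (by positivity) (hs i)).trans (by simp)
    calc (s i ^ 2)⁻¹ = (s i)⁻¹ ^ 2 := by rw [inv_pow]
      _ ≤ √L ^ 2 := by gcongr
      _ = L := Real.sq_sqrt hL.le
  set T := ∑ j, (x j - m j) ^ 2 / (2 * s j ^ 2) with hT
  have h2 : (x i - m i) ^ 2 / (2 * s i ^ 2) ≤ T :=
    Finset.single_le_sum (f := fun j => (x j - m j) ^ 2 / (2 * s j ^ 2))
      (fun j _ => by positivity) (Finset.mem_univ i)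
  have h3 : gaussianScore m s x i ^ 2 ≤ 2 * L * T := by
    calc gaussianScore m s x i ^ 2
        = 2 * (s i ^ 2)⁻¹ * ((x i - m i) ^ 2 / (2 * s i ^ 2)) := by
          rw [gaussianScore]; field_simp
      _ ≤ 2 * L * T := by gcongr
  have h4 : T * Real.exp (-T) ≤ 1 := by
    rw [Real.exp_neg, mul_inv_le_iff₀ (Real.exp_pos _), one_mul]
    linarith [Real.add_one_le_exp T]
  have hT0 : 0 ≤ T := Finset.sum_nonneg fun j _ => by positivity
  calc _ ≤ (√L ^ d * Real.exp (-T)) * (2 * L * T) := by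
        gcongr
        exact diagGaussianDensity_le_exp hL hs x
    _ = √L ^ d * (2 * L) * (T * Real.exp (-T)) := by ring
    _ ≤ √L ^ d * (2 * L) * 1 := by gcongr
    _ = _ := mul_one _

theorem abs_diagGaussianDensity_mul_score_le (hL : 0 < L) (hs : ∀ i, 1 / √L ≤ s i)
    (x : EuclideanSpace ℝ (Fin d)) (i : Fin d) :
    |diagGaussianDensity m s x * gaussianScore m s x i| ≤ √L ^ d * (1 + 2 * L) := by
  have h0 : 0 ≤ diagGaussianDensity m s x :=
    (diagGaussianDensity_pos (fun i => (by positivity : 0 < 1 / √L).trans_le (hs i)) x).le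
  have h1 := diagGaussianDensity_le (m := m) hL hs x
  have h2 := diagGaussianDensity_mul_score_sq_le (m := m) hL hs x i
  rw [abs_mul, abs_of_nonneg h0]
  have h3 : |gaussianScore m s x i| ≤ 1 + gaussianScore m s x i ^ 2 := by
    rw [← sq_abs]
    nlinarith [sq_nonneg (|gaussianScore m s x i| - 1), abs_nonneg (gaussianScore m s x i)]
  calc _ ≤ diagGaussianDensity m s x * (1 + gaussianScore m s x i ^ 2) := by gcongr
    _ ≤ _ := by linarith

end Bounds

end Gaussian

/-! ### Density, law and score of a Gaussian mixture -/

section Mixture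

variable {d : ℕ} {Z : Type*} [MeasurableSpace Z] {m s : Z → EuclideanSpace ℝ (Fin d)}

/-- The sample of the mixture of the diagonal Gaussians `N(m z, diag(s z)²)` obtained from a mixing
variable and standard Gaussian noise. -/
def reparam (m s : Z → EuclideanSpace ℝ (Fin d)) (u : Z × (Fin d → ℝ)) :
    EuclideanSpace ℝ (Fin d) :=
  m u.1 + diagMul u.2 (s u.1)

/-- The density of the mixture of the diagonal Gaussians `N(m z, diag(s z)²)`. -/
def mixture (ν : Measure Z) (m s : Z → EuclideanSpace ℝ (Fin d))
    (x : EuclideanSpace ℝ (Fin d)) : ℝ :=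
  ∫ z, diagGaussianDensity (m z) (s z) x ∂ν

/-- The partial derivatives of the density of a mixture of diagonal Gaussians. -/
def mixturePartial (ν : Measure Z) (m s : Z → EuclideanSpace ℝ (Fin d)) (i : Fin d)
    (x : EuclideanSpace ℝ (Fin d)) : ℝ :=
  ∫ z, diagGaussianDensity (m z) (s z) x * gaussianScore (m z) (s z) x i ∂ν

theorem measurable_reparam (hm : Measurable m) (hs : Measurable s) : Measurable (reparam m s) :=
  (hm.comp measurable_fst).add (measurable_diagMul measurable_snd (hs.comp measurable_fst))

theorem measurable_coord {α : Type*} [MeasurableSpace α] {g : α → EuclideanSpace ℝ (Fin d)}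
    (hg : Measurable g) (i : Fin d) : Measurable fun a => g a i :=
  (EuclideanSpace.proj i : EuclideanSpace ℝ (Fin d) →L[ℝ] ℝ).continuous.measurable.comp hg

theorem measurable_diagGaussianDensity (hm : Measurable m) (hs : Measurable s) :
    Measurable fun p : Z × EuclideanSpace ℝ (Fin d) =>
      diagGaussianDensity (m p.1) (s p.1) p.2 := by
  refine Finset.measurable_fun_prod _ fun i _ => ?_
  refine measurable_uncurry_gaussianPDFReal.comp (Measurable.prodMk ?_ (Measurable.prodMk ?_ ?_))
  · exact measurable_coord (hm.comp measurable_fst) i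
  · exact (measurable_coord (hs.comp measurable_fst) i).nnnorm.pow_const 2
  · exact measurable_coord measurable_snd i

theorem measurable_gaussianScore (hm : Measurable m) (hs : Measurable s) (i : Fin d) :
    Measurable fun p : Z × EuclideanSpace ℝ (Fin d) => gaussianScore (m p.1) (s p.1) p.2 i :=
  (((measurable_coord measurable_snd i).sub (measurable_coord (hm.comp measurable_fst) i)).div
    ((measurable_coord (hs.comp measurable_fst) i).pow_const 2)).neg

variable {ν : Measure Z} {L : ℝ}

/-- The joint law of the mixing variable and the sample. -/
theorem withDensity_prod_eq_map (hm : Measurable m) (hs : Measurable s)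
    (hs0 : ∀ z i, 0 < s z i) :
    (ν.prod volume).withDensity
        (fun p => ENNReal.ofReal (diagGaussianDensity (m p.1) (s p.1) p.2)) =
      (ν.prod (stdNormal d)).map fun u => (u.1, reparam m s u) := by
  have hG := (measurable_diagGaussianDensity hm hs).ennreal_ofReal
  have hr : Measurable fun u : Z × (Fin d → ℝ) => (u.1, reparam m s u) :=
    measurable_fst.prodMk (measurable_reparam hm hs)
  ext A hA
  rw [withDensity_apply _ hA, Measure.map_apply hr hA, Measure.prod_apply (hr hA),
    ← lintegral_indicator hA, lintegral_prod _ (hG.indicator hA).aemeasurable]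
  refine lintegral_congr fun z => ?_
  have hAz : MeasurableSet (Prod.mk z ⁻¹' A) := measurable_prodMk_left hA
  have hmz : Measurable fun ξ => m z + diagMul ξ (s z) :=
    measurable_const.add (measurable_diagMul measurable_id measurable_const)
  have h1 := congrArg (fun κ => κ (Prod.mk z ⁻¹' A))
    (withDensity_diagGaussianDensity (m z) (hs0 z))
  rw [withDensity_apply _ hAz, ← lintegral_indicator hAz, Measure.map_apply hmz hAz] at h1
  exact h1

variable [IsProbabilityMeasure ν]

theorem integrable_diagGaussianDensity (hm : Measurable m) (hs : Measurable s) (hL : 0 < L)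
    (hs0 : ∀ z i, 1 / √L ≤ s z i) (x : EuclideanSpace ℝ (Fin d)) :
    Integrable (fun z => diagGaussianDensity (m z) (s z) x) ν := by
  refine Integrable.of_bound ((measurable_diagGaussianDensity hm hs).comp
    measurable_prodMk_right).aestronglyMeasurable (√L ^ d) (ae_of_all _ fun z => ?_)
  have hL' := Real.sqrt_pos.2 hL
  rw [Real.norm_of_nonneg (diagGaussianDensity_pos
    (fun i => (by positivity : 0 < 1 / √L).trans_le (hs0 z i)) x).le]
  exact diagGaussianDensity_le hL (hs0 z) x

theorem integrable_diagGaussianDensity_mul_score (hm : Measurable m) (hs : Measurable s)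
    (hL : 0 < L) (hs0 : ∀ z i, 1 / √L ≤ s z i) (i : Fin d) (x : EuclideanSpace ℝ (Fin d)) :
    Integrable (fun z => diagGaussianDensity (m z) (s z) x * gaussianScore (m z) (s z) x i) ν :=
  Integrable.of_bound (((measurable_diagGaussianDensity hm hs).mul
    (measurable_gaussianScore hm hs i)).comp measurable_prodMk_right).aestronglyMeasurable
    (√L ^ d * (1 + 2 * L)) (ae_of_all _ fun z =>
      abs_diagGaussianDensity_mul_score_le hL (hs0 z) x i)

theorem integrable_diagGaussianDensity_mul_score_sq (hm : Measurable m) (hs : Measurable s)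
    (hL : 0 < L) (hs0 : ∀ z i, 1 / √L ≤ s z i) (i : Fin d) (x : EuclideanSpace ℝ (Fin d)) :
    Integrable (fun z => diagGaussianDensity (m z) (s z) x * gaussianScore (m z) (s z) x i ^ 2)
      ν := by
  refine Integrable.of_bound (((measurable_diagGaussianDensity hm hs).mul
    ((measurable_gaussianScore hm hs i).pow_const 2)).comp
    measurable_prodMk_right).aestronglyMeasurable
    (√L ^ d * (2 * L)) (ae_of_all _ fun z => ?_)
  have hL' := Real.sqrt_pos.2 hL
  have := (diagGaussianDensity_pos (m := m z)
    (fun i => (by positivity : 0 < 1 / √L).trans_le (hs0 z i)) x).le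
  rw [Real.norm_of_nonneg (mul_nonneg this (sq_nonneg _))]
  exact diagGaussianDensity_mul_score_sq_le hL (hs0 z) x i

theorem mixture_pos (hm : Measurable m) (hs : Measurable s) (hL : 0 < L)
    (hs0 : ∀ z i, 1 / √L ≤ s z i) (x : EuclideanSpace ℝ (Fin d)) : 0 < mixture ν m s x := by
  have hL' := Real.sqrt_pos.2 hL
  have hpos : ∀ z, 0 < diagGaussianDensity (m z) (s z) x := fun z =>
    diagGaussianDensity_pos (fun i => (by positivity : 0 < 1 / √L).trans_le (hs0 z i)) x
  refine (integral_pos_iff_support_of_nonneg (fun z => (hpos z).le)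
    (integrable_diagGaussianDensity hm hs hL hs0 x)).2 ?_
  have : Function.support (fun z => diagGaussianDensity (m z) (s z) x) = Set.univ :=
    Set.eq_univ_of_forall fun z => (hpos z).ne'
  rw [this]
  simp

theorem measurable_mixture (hm : Measurable m) (hs : Measurable s) :
    Measurable (mixture ν m s) :=
  (measurable_diagGaussianDensity hm hs).stronglyMeasurable.integral_prod_left'.measurable

theorem measurable_mixturePartial (hm : Measurable m) (hs : Measurable s) (i : Fin d) :
    Measurable (mixturePartial ν m s i) :=
  ((measurable_diagGaussianDensity hm hs).mul
    (measurable_gaussianScore hm hs i)).stronglyMeasurable.integral_prod_left'.measurable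

/-- The law of the sample has the mixture density. -/
theorem densityMeasure_mixture (hm : Measurable m) (hs : Measurable s) (hL : 0 < L)
    (hs0 : ∀ z i, 1 / √L ≤ s z i) :
    densityMeasure (mixture ν m s) = (ν.prod (stdNormal d)).map (reparam m s) := by
  have hL' := Real.sqrt_pos.2 hL
  have hpos : ∀ z i, 0 < s z i := fun z i => (by positivity : 0 < 1 / √L).trans_le (hs0 z i)
  have hG := (measurable_diagGaussianDensity hm hs).ennreal_ofReal
  have h1 : (ν.prod (stdNormal d)).map (reparam m s) =
      ((ν.prod (stdNormal d)).map fun u => (u.1, reparam m s u)).map Prod.snd := by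
    rw [Measure.map_map measurable_snd (measurable_fst.prodMk (measurable_reparam hm hs))]
    rfl
  rw [h1, ← withDensity_prod_eq_map hm hs hpos]
  ext A hA
  have hA' : (Prod.snd ⁻¹' A : Set (Z × EuclideanSpace ℝ (Fin d))) = Set.univ ×ˢ A := by
    ext; simp
  rw [densityMeasure, withDensity_apply _ hA, Measure.map_apply measurable_snd hA,
    withDensity_apply _ (measurable_snd hA), hA', ← Measure.prod_restrict, Measure.restrict_univ,
    lintegral_prod_symm _ hG.aemeasurable]
  refine lintegral_congr fun x => ?_
  exact ofReal_integral_eq_lintegral_ofReal (integrable_diagGaussianDensity hm hs hL hs0 x)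
    (ae_of_all _ fun z => (diagGaussianDensity_pos (hpos z) x).le)

/-- The derivatives of the components are bounded uniformly in the mixing variable and the point, so
a constant dominates them on the whole space. -/
theorem hasFDerivAt_mixture (hm : Measurable m) (hs : Measurable s) (hL : 0 < L)
    (hs0 : ∀ z i, 1 / √L ≤ s z i) (x : EuclideanSpace ℝ (Fin d)) :
    HasFDerivAt (mixture ν m s) (∑ i, mixturePartial ν m s i x •
      (EuclideanSpace.proj i : EuclideanSpace ℝ (Fin d) →L[ℝ] ℝ)) x := by
  have hint := fun i => integrable_diagGaussianDensity_mul_score (ν := ν) hm hs hL hs0 i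
  have hint' : ∀ x i, Integrable (fun z =>
      (diagGaussianDensity (m z) (s z) x * gaussianScore (m z) (s z) x i) •
        (EuclideanSpace.proj i : EuclideanSpace ℝ (Fin d) →L[ℝ] ℝ)) ν :=
    fun x i => (hint i x).smul_const _
  set F' : EuclideanSpace ℝ (Fin d) → Z → EuclideanSpace ℝ (Fin d) →L[ℝ] ℝ := fun x z =>
    ∑ i, (diagGaussianDensity (m z) (s z) x * gaussianScore (m z) (s z) x i) •
      (EuclideanSpace.proj i : EuclideanSpace ℝ (Fin d) →L[ℝ] ℝ) with hF'
  have hmeas : AEStronglyMeasurable (F' x) ν :=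
    Finset.aestronglyMeasurable_fun_sum _ fun i _ => (hint' x i).aestronglyMeasurable
  have hle : ∀ z, ∀ y ∈ Set.univ, ‖F' y z‖ ≤ ∑ i, √L ^ d * (1 + 2 * L) *
      ‖(EuclideanSpace.proj i : EuclideanSpace ℝ (Fin d) →L[ℝ] ℝ)‖ := by
    intro z y _
    refine norm_sum_le_of_le _ fun i _ => ?_
    rw [norm_smul]
    gcongr
    exact abs_diagGaussianDensity_mul_score_le hL (hs0 z) y i
  have h := hasFDerivAt_integral_of_dominated_of_fderiv_le (μ := ν) (x₀ := x) (s := Set.univ)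
    (F := fun x z => diagGaussianDensity (m z) (s z) x) (F' := F') Filter.univ_mem
    (Filter.Eventually.of_forall fun y =>
      (integrable_diagGaussianDensity hm hs hL hs0 y).aestronglyMeasurable)
    (integrable_diagGaussianDensity hm hs hL hs0 x) hmeas (ae_of_all _ hle)
    (integrable_const _) (ae_of_all _ fun z y _ => hasFDerivAt_diagGaussianDensity _ _ _)
  have hd : ∫ z, F' x z ∂ν = ∑ i, mixturePartial ν m s i x •
      (EuclideanSpace.proj i : EuclideanSpace ℝ (Fin d) →L[ℝ] ℝ) := by
    refine (integral_finsetSum _ fun i _ => hint' x i).trans ?_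
    refine Finset.sum_congr rfl fun i _ => ?_
    rw [mixturePartial, integral_smul_const]
  rw [← hd]
  exact h

theorem gradient_apply_eq_fderiv (g : EuclideanSpace ℝ (Fin d) → ℝ) (x : EuclideanSpace ℝ (Fin d))
    (i : Fin d) : ∇ g x i = fderiv ℝ g x (EuclideanSpace.single i 1) := by
  rw [← toDual_gradient, InnerProductSpace.toDual_apply_apply, EuclideanSpace.inner_single_right]
  simp

theorem gradLogRatio_mixture {p : EuclideanSpace ℝ (Fin d) → ℝ} (hp : ∀ x, 0 < p x)
    (hpd : Differentiable ℝ fun x => Real.log (p x)) (hm : Measurable m) (hs : Measurable s)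
    (hL : 0 < L) (hs0 : ∀ z i, 1 / √L ≤ s z i) (x : EuclideanSpace ℝ (Fin d)) (i : Fin d) :
    gradLogRatio p (mixture ν m s) x i =
      ∇ (fun x => Real.log (p x)) x i - mixturePartial ν m s i x / mixture ν m s x := by
  have hq := fun x => mixture_pos (ν := ν) hm hs hL hs0 x
  have h1 : (fun x => Real.log (p x / mixture ν m s x)) =
      fun x => Real.log (p x) - Real.log (mixture ν m s x) :=
    funext fun x => Real.log_div (hp x).ne' (hq x).ne'
  have h2 := (hpd x).hasFDerivAt.fun_sub
    ((hasFDerivAt_mixture (ν := ν) hm hs hL hs0 x).log (hq x).ne')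
  rw [gradLogRatio, h1, gradient_apply_eq_fderiv, gradient_apply_eq_fderiv, h2.fderiv]
  simp [div_eq_inv_mul]

/-- The square of the score of the mixture is at most the average of the squares of the scores of
its components. -/
theorem mixturePartial_sq_le (hm : Measurable m) (hs : Measurable s) (hL : 0 < L)
    (hs0 : ∀ z i, 1 / √L ≤ s z i) (i : Fin d) (x : EuclideanSpace ℝ (Fin d)) :
    mixture ν m s x * (mixturePartial ν m s i x / mixture ν m s x) ^ 2 ≤
      ∫ z, diagGaussianDensity (m z) (s z) x * gaussianScore (m z) (s z) x i ^ 2 ∂ν := by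
  have hL' := Real.sqrt_pos.2 hL
  have hpos : ∀ z i, 0 < s z i := fun z i => (by positivity : 0 < 1 / √L).trans_le (hs0 z i)
  have hq := mixture_pos (ν := ν) hm hs hL hs0 x
  set c := mixturePartial ν m s i x / mixture ν m s x with hc
  have i0 := integrable_diagGaussianDensity (ν := ν) hm hs hL hs0 x
  have i1 := integrable_diagGaussianDensity_mul_score (ν := ν) hm hs hL hs0 i x
  have i2 := integrable_diagGaussianDensity_mul_score_sq (ν := ν) hm hs hL hs0 i x
  have i3 : Integrable (fun z => diagGaussianDensity (m z) (s z) x *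
      gaussianScore (m z) (s z) x i ^ 2 - 2 * c * (diagGaussianDensity (m z) (s z) x *
      gaussianScore (m z) (s z) x i)) ν := i2.sub (i1.const_mul _)
  -- The constant `c` is the posterior mean of the component scores, so this is their variance
  -- weighted by the density; expanding its nonnegativity gives the claim.
  have h0 : 0 ≤ ∫ z, diagGaussianDensity (m z) (s z) x *
      (gaussianScore (m z) (s z) x i - c) ^ 2 ∂ν :=
    integral_nonneg fun z => mul_nonneg (diagGaussianDensity_pos (hpos z) x).le (sq_nonneg _)
  have h1 : ∫ z, diagGaussianDensity (m z) (s z) x * (gaussianScore (m z) (s z) x i - c) ^ 2 ∂ν =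
      (∫ z, diagGaussianDensity (m z) (s z) x * gaussianScore (m z) (s z) x i ^ 2 ∂ν) -
        2 * c * mixturePartial ν m s i x + c ^ 2 * mixture ν m s x := by
    rw [mixture, mixturePartial, ← integral_const_mul, ← integral_const_mul,
      ← integral_sub i2 (i1.const_mul _), ← integral_add i3 (i0.const_mul _)]
    refine integral_congr_ae (ae_of_all _ fun z => ?_)
    ring
  have h2 : mixturePartial ν m s i x = c * mixture ν m s x := by
    rw [hc]; field_simp
  rw [h1, h2] at h0
  nlinarith

end Mixture

/-! ### The loss as a double integral over reparametrized samples -/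

section Loss

/-- Bilinearity and Fubini. For feature vectors the inner product is the kernel, so this removes the
Hilbert space from the loss. -/
theorem norm_integral_sq_eq {Ω H : Type*} [MeasurableSpace Ω] {P : Measure Ω} [SFinite P]
    [NormedAddCommGroup H] [InnerProductSpace ℝ H] [CompleteSpace H] {g : Ω → H}
    (hg : Integrable g P) :
    Integrable (fun p : Ω × Ω => inner ℝ (g p.1) (g p.2)) (P.prod P) ∧
      ‖∫ ω, g ω ∂P‖ ^ 2 = ∫ p : Ω × Ω, inner ℝ (g p.1) (g p.2) ∂(P.prod P) := by
  have hint : Integrable (fun p : Ω × Ω => inner ℝ (g p.1) (g p.2)) (P.prod P) :=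
    (hg.norm.mul_prod hg.norm).mono'
      (hg.aestronglyMeasurable.comp_fst.inner hg.aestronglyMeasurable.comp_snd)
      (ae_of_all _ fun p => norm_inner_le_norm _ _)
  refine ⟨hint, ?_⟩
  rw [integral_prod _ hint, ← real_inner_self_eq_norm_sq, ← integral_inner hg]
  refine integral_congr_ae (ae_of_all _ fun ω => ?_)
  simp only
  rw [integral_inner hg, real_inner_comm]

theorem integrable_densityMeasure_iff {d : ℕ} {F : Type*} [NormedAddCommGroup F] [NormedSpace ℝ F]
    {q : EuclideanSpace ℝ (Fin d) → ℝ} (hq : Measurable q) (hq0 : ∀ x, 0 ≤ q x)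
    {g : EuclideanSpace ℝ (Fin d) → F} :
    Integrable g (densityMeasure q) ↔ Integrable fun x => q x • g x := by
  rw [densityMeasure, integrable_withDensity_iff_integrable_smul' hq.ennreal_ofReal
    (ae_of_all _ fun x => ENNReal.ofReal_lt_top)]
  simp only [ENNReal.toReal_ofReal (hq0 _)]

theorem integral_densityMeasure {d : ℕ} {F : Type*} [NormedAddCommGroup F] [NormedSpace ℝ F]
    {q : EuclideanSpace ℝ (Fin d) → ℝ} (hq : Measurable q) (hq0 : ∀ x, 0 ≤ q x)
    (g : EuclideanSpace ℝ (Fin d) → F) :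
    ∫ x, g x ∂densityMeasure q = ∫ x, q x • g x := by
  rw [densityMeasure, integral_withDensity_eq_integral_toReal_smul hq.ennreal_ofReal
    (ae_of_all _ fun x => ENNReal.ofReal_lt_top)]
  simp only [ENNReal.toReal_ofReal (hq0 _)]

variable {d : ℕ} {Z : Type*} [MeasurableSpace Z] {m s : Z → EuclideanSpace ℝ (Fin d)}
  {ν : Measure Z} {L : ℝ}

section Joint

variable {F : Type*} [NormedAddCommGroup F] [NormedSpace ℝ F]
  {g : Z × EuclideanSpace ℝ (Fin d) → F}

/-- Both sides concern `g` under the joint law of mixing variable and sample, written once by its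
density and once as an image of the noise. -/
theorem integrable_prod_smul_iff (hm : Measurable m) (hs : Measurable s)
    (hs0 : ∀ z i, 0 < s z i) (hg : StronglyMeasurable g) :
    Integrable (fun p => diagGaussianDensity (m p.1) (s p.1) p.2 • g p) (ν.prod volume) ↔
      Integrable (fun u => g (u.1, reparam m s u)) (ν.prod (stdNormal d)) := by
  have h := integrable_map_measure (μ := ν.prod (stdNormal d)) (g := g) hg.aestronglyMeasurable
    (measurable_fst.prodMk (measurable_reparam hm hs)).aemeasurable
  rw [← withDensity_prod_eq_map hm hs hs0, integrable_withDensity_iff_integrable_smul'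
    (measurable_diagGaussianDensity hm hs).ennreal_ofReal
    (ae_of_all _ fun x => ENNReal.ofReal_lt_top)] at h
  simp only [ENNReal.toReal_ofReal (diagGaussianDensity_pos (hs0 _) _).le] at h
  exact h

theorem integral_prod_smul (hm : Measurable m) (hs : Measurable s)
    (hs0 : ∀ z i, 0 < s z i) (hg : StronglyMeasurable g) :
    ∫ p, diagGaussianDensity (m p.1) (s p.1) p.2 • g p ∂(ν.prod volume) =
      ∫ u, g (u.1, reparam m s u) ∂(ν.prod (stdNormal d)) := by
  have h := integral_map (μ := ν.prod (stdNormal d)) (f := g)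
    (measurable_fst.prodMk (measurable_reparam hm hs)).aemeasurable hg.aestronglyMeasurable
  rw [← withDensity_prod_eq_map hm hs hs0, integral_withDensity_eq_integral_toReal_smul
    (measurable_diagGaussianDensity hm hs).ennreal_ofReal
    (ae_of_all _ fun x => ENNReal.ofReal_lt_top)] at h
  simp only [ENNReal.toReal_ofReal (diagGaussianDensity_pos (hs0 _) _).le] at h
  exact h

end Joint

variable [IsProbabilityMeasure ν]

theorem memLp_noise (i : Fin d) : MemLp (fun ξ : Fin d → ℝ => ξ i) 2 (stdNormal d) :=
  (memLp_id_gaussianReal 2).comp_measurePreserving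
    (measurePreserving_eval (fun _ : Fin d => gaussianReal 0 1) i)

theorem inv_le_sqrt {t : ℝ} (hL : 0 < L) (ht : 1 / √L ≤ t) : t⁻¹ ≤ √L := by
  have := Real.sqrt_pos.2 hL
  exact (inv_anti₀ (by positivity) ht).trans (by simp)

theorem memLp_noise_div (hs : Measurable s) (hL : 0 < L) (hs0 : ∀ z i, 1 / √L ≤ s z i)
    (i : Fin d) :
    MemLp (fun u : Z × (Fin d → ℝ) => u.2 i / s u.1 i) 2 (ν.prod (stdNormal d)) := by
  have hL' := Real.sqrt_pos.2 hL
  have h := (memLp_noise i).comp_measurePreserving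
    (measurePreserving_snd (μ := ν) (ν := stdNormal d))
  refine (h.const_mul √L).mono (((measurable_pi_apply i).comp measurable_snd).div
    (measurable_coord (hs.comp measurable_fst) i)).aestronglyMeasurable (ae_of_all _ fun u => ?_)
  have h0 : 0 < s u.1 i := (by positivity : 0 < 1 / √L).trans_le (hs0 u.1 i)
  rw [norm_div, norm_mul, Real.norm_of_nonneg h0.le, Real.norm_of_nonneg hL'.le, div_eq_inv_mul]
  exact mul_le_mul_of_nonneg_right (inv_le_sqrt hL (hs0 _ _)) (norm_nonneg _)

/-- The mixture score is a posterior average of component scores, so by Jensen its second moment is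
at most that of ξ_i/s_i, which is finite because 1/s_i ≤ √L. -/
theorem memLp_mixturePartial_div (hm : Measurable m) (hs : Measurable s) (hL : 0 < L)
    (hs0 : ∀ z i, 1 / √L ≤ s z i) (i : Fin d) :
    MemLp (fun x => mixturePartial ν m s i x / mixture ν m s x) 2
      (densityMeasure (mixture ν m s)) := by
  have hL' := Real.sqrt_pos.2 hL
  have hpos : ∀ z i, 0 < s z i := fun z i => (by positivity : 0 < 1 / √L).trans_le (hs0 z i)
  have hq := fun x => (mixture_pos (ν := ν) hm hs hL hs0 x).le
  have hmeas : Measurable fun x => mixturePartial ν m s i x / mixture ν m s x :=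
    (measurable_mixturePartial hm hs i).div (measurable_mixture hm hs)
  have hsc := measurable_gaussianScore hm hs i
  rw [memLp_two_iff_integrable_sq hmeas.aestronglyMeasurable,
    integrable_densityMeasure_iff (measurable_mixture hm hs) hq]
  have h1 : Integrable (fun p => diagGaussianDensity (m p.1) (s p.1) p.2 •
      gaussianScore (m p.1) (s p.1) p.2 i ^ 2) (ν.prod volume) := by
    rw [integrable_prod_smul_iff hm hs hpos (hsc.pow_const 2).stronglyMeasurable]
    refine ((memLp_two_iff_integrable_sq
      (memLp_noise_div hs hL hs0 i).aestronglyMeasurable).1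
      (memLp_noise_div (ν := ν) hs hL hs0 i)).congr (ae_of_all _ fun u => ?_)
    simp only
    rw [reparam, gaussianScore_add_diagMul _ (hpos _), neg_sq]
  refine h1.integral_prod_right.mono' ((measurable_mixture hm hs).smul
    (hmeas.pow_const 2)).aestronglyMeasurable (ae_of_all _ fun x => ?_)
  rw [smul_eq_mul, Real.norm_of_nonneg (mul_nonneg (hq x) (sq_nonneg _))]
  exact mixturePartial_sq_le hm hs hL hs0 i x

/-- The vector of inverses of the coordinates. -/
def invVec (v : EuclideanSpace ℝ (Fin d)) : EuclideanSpace ℝ (Fin d) :=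
  WithLp.toLp 2 fun i => (v i)⁻¹

@[simp]
theorem invVec_apply (v : EuclideanSpace ℝ (Fin d)) (i : Fin d) : invVec v i = (v i)⁻¹ := rfl

theorem measurable_invVec {α : Type*} [MeasurableSpace α] {g : α → EuclideanSpace ℝ (Fin d)}
    (hg : Measurable g) : Measurable fun a => invVec (g a) :=
  (MeasurableEquiv.toLp 2 (Fin d → ℝ)).measurable.comp
    (measurable_pi_lambda _ fun i => (measurable_coord hg i).inv)

/-- The difference of the target score and the conditional score at a sample point. -/
def scoreGap (p : EuclideanSpace ℝ (Fin d) → ℝ) (m s : Z → EuclideanSpace ℝ (Fin d))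
    (u : Z × (Fin d → ℝ)) : EuclideanSpace ℝ (Fin d) :=
  ∇ (fun x => Real.log (p x)) (reparam m s u) + diagMul u.2 (invVec (s u.1))

theorem measurable_scoreGap {p : EuclideanSpace ℝ (Fin d) → ℝ} (hm : Measurable m)
    (hs : Measurable s) (hp : Continuous (∇ fun x => Real.log (p x))) :
    Measurable (scoreGap p m s) :=
  (hp.measurable.comp (measurable_reparam hm hs)).add
    (measurable_diagMul measurable_snd (measurable_invVec (hs.comp measurable_fst)))

theorem memLp_coord {α : Type*} [MeasurableSpace α] {P : Measure α}
    {g : α → EuclideanSpace ℝ (Fin d)} (hg : MemLp g 2 P) (i : Fin d) :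
    MemLp (fun a => g a i) 2 P :=
  (EuclideanSpace.proj i : EuclideanSpace ℝ (Fin d) →L[ℝ] ℝ).comp_memLp' hg

theorem memLp_of_coord {α : Type*} [MeasurableSpace α] {P : Measure α}
    {g : α → EuclideanSpace ℝ (Fin d)} (hg : ∀ i, MemLp (fun a => g a i) 2 P) : MemLp g 2 P := by
  have h : g = fun a => ∑ i, g a i • EuclideanSpace.single i (1 : ℝ) := by
    funext a
    ext j
    simp [Finset.sum_apply, Pi.single_apply]
  rw [h]
  exact memLp_finsetSum _ fun i _ =>
    (ContinuousLinearMap.toSpanSingleton ℝ (EuclideanSpace.single i (1 : ℝ))).comp_memLp' (hg i)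

theorem memLp_scoreGap {p : EuclideanSpace ℝ (Fin d) → ℝ} (hs : Measurable s) (hL : 0 < L)
    (hs0 : ∀ z i, 1 / √L ≤ s z i)
    (hp2 : MemLp (fun u => ∇ (fun x => Real.log (p x)) (reparam m s u)) 2
      (ν.prod (stdNormal d))) : MemLp (scoreGap p m s) 2 (ν.prod (stdNormal d)) := by
  refine hp2.add (memLp_of_coord fun i => ?_)
  simp only [diagMul_apply, invVec_apply, ← div_eq_mul_inv]
  exact memLp_noise_div hs hL hs0 i

theorem memLp_gradLogRatio {p : EuclideanSpace ℝ (Fin d) → ℝ} (hp : ∀ x, 0 < p x)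
    (hpd : Differentiable ℝ fun x => Real.log (p x))
    (hpc : Continuous (∇ fun x => Real.log (p x))) (hm : Measurable m) (hs : Measurable s)
    (hL : 0 < L) (hs0 : ∀ z i, 1 / √L ≤ s z i)
    (hp2 : MemLp (fun u => ∇ (fun x => Real.log (p x)) (reparam m s u)) 2
      (ν.prod (stdNormal d))) :
    MemLp (gradLogRatio p (mixture ν m s)) 2 (densityMeasure (mixture ν m s)) := by
  refine memLp_of_coord fun i => ?_
  simp only [gradLogRatio_mixture hp hpd hm hs hL hs0]
  refine MemLp.sub (memLp_coord ?_ i) (memLp_mixturePartial_div hm hs hL hs0 i)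
  rw [densityMeasure_mixture hm hs hL hs0]
  exact (memLp_map_measure_iff hpc.aestronglyMeasurable (measurable_reparam hm hs).aemeasurable).2
    hp2

/-- The weight `q` of the measure cancels the denominator of the score. What remains is a double
integral of component scores; Fubini and the joint law rewrite it over the noise. This is the step
that removes the intractable score. -/
theorem integral_mixturePartial_div_smul {F : Type*} [NormedAddCommGroup F] [NormedSpace ℝ F]
    [CompleteSpace F] {κ : EuclideanSpace ℝ (Fin d) → F}
    (hκ : StronglyMeasurable κ) {C : ℝ} (hC : ∀ x, ‖κ x‖ ≤ C) (hm : Measurable m)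
    (hs : Measurable s) (hL : 0 < L) (hs0 : ∀ z i, 1 / √L ≤ s z i) (i : Fin d) :
    ∫ x, (mixturePartial ν m s i x / mixture ν m s x) • κ x ∂densityMeasure (mixture ν m s) =
      ∫ u, -(u.2 i / s u.1 i) • κ (reparam m s u) ∂(ν.prod (stdNormal d)) := by
  have hL' := Real.sqrt_pos.2 hL
  have hpos : ∀ z i, 0 < s z i := fun z i => (by positivity : 0 < 1 / √L).trans_le (hs0 z i)
  have hq := fun x => mixture_pos (ν := ν) hm hs hL hs0 x
  have hg : StronglyMeasurable fun p : Z × EuclideanSpace ℝ (Fin d) =>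
      gaussianScore (m p.1) (s p.1) p.2 i • κ p.2 :=
    (measurable_gaussianScore hm hs i).stronglyMeasurable.smul
      (hκ.comp_measurable measurable_snd)
  have hu : ∀ u : Z × (Fin d → ℝ), gaussianScore (m u.1) (s u.1) (reparam m s u) i •
      κ (reparam m s u) = -(u.2 i / s u.1 i) • κ (reparam m s u) := fun u => by
    rw [reparam, gaussianScore_add_diagMul _ (hpos _)]
  have hint : Integrable (fun p => diagGaussianDensity (m p.1) (s p.1) p.2 •
      (gaussianScore (m p.1) (s p.1) p.2 i • κ p.2)) (ν.prod volume) := by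
    rw [integrable_prod_smul_iff hm hs hpos hg]
    simp only [hu]
    have h1 : Integrable (fun u : Z × (Fin d → ℝ) => -(u.2 i / s u.1 i))
        (ν.prod (stdNormal d)) :=
      ((memLp_noise_div hs hL hs0 i).integrable (by norm_num)).neg
    exact h1.smul_bdd C
      (hκ.comp_measurable (measurable_reparam hm hs)).aestronglyMeasurable
      (ae_of_all _ fun u => hC _)
  have h2 := integral_prod_smul (ν := ν) hm hs hpos hg
  simp only [hu] at h2
  rw [← h2, integral_prod_symm _ hint,
    integral_densityMeasure (measurable_mixture hm hs) fun x => (hq x).le]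
  refine integral_congr_ae (ae_of_all _ fun x => ?_)
  simp only [smul_smul]
  rw [integral_smul_const, mul_div_cancel₀ _ (hq x).ne']
  rfl

/-- In each coordinate the integral operator becomes an average of feature vectors weighted by
`scoreGap`; squaring the norms and summing over coordinates reassembles the inner product of the two
gaps. -/
theorem ksd_mixture_sq (H : Type*) [NormedAddCommGroup H] [InnerProductSpace ℝ H]
    [CompleteSpace H] [RKHS ℝ H (EuclideanSpace ℝ (Fin d)) ℝ]
    {k : EuclideanSpace ℝ (Fin d) → EuclideanSpace ℝ (Fin d) → ℝ}
    (hk : ∀ x y, RKHS.kernel H x y (1 : ℝ) = k x y) {B : ℝ} (hB : 0 ≤ B) (hkB : BoundedKernel k B)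
    {p : EuclideanSpace ℝ (Fin d) → ℝ} (hp : ∀ x, 0 < p x)
    (hpd : Differentiable ℝ fun x => Real.log (p x))
    (hpc : Continuous (∇ fun x => Real.log (p x))) (hm : Measurable m) (hs : Measurable s)
    (hL : 0 < L) (hs0 : ∀ z i, 1 / √L ≤ s z i)
    (hp2 : MemLp (fun u => ∇ (fun x => Real.log (p x)) (reparam m s u)) 2
      (ν.prod (stdNormal d))) :
    ksd H (mixture ν m s) p ^ 2 = ∫ u : (Z × (Fin d → ℝ)) × (Z × (Fin d → ℝ)),
      k (reparam m s u.1) (reparam m s u.2) * inner ℝ (scoreGap p m s u.1) (scoreGap p m s u.2)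
        ∂((ν.prod (stdNormal d)).prod (ν.prod (stdNormal d))) := by
  set κ : EuclideanSpace ℝ (Fin d) → H := fun x => RKHS.kerFun H x (1 : ℝ) with hκdef
  have hκc : Continuous κ := continuous_kerFun H hk hkB.differentiable.continuous
  have hκ : StronglyMeasurable κ := hκc.stronglyMeasurable
  have hC : ∀ x, ‖κ x‖ ≤ B := norm_kerFun_le H hk hB hkB.bound
  have hr := measurable_reparam hm hs
  have hκr : AEStronglyMeasurable (fun u => κ (reparam m s u)) (ν.prod (stdNormal d)) :=
    (hκ.comp_measurable hr).aestronglyMeasurable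
  have hsm : ∀ {g : Z × (Fin d → ℝ) → ℝ}, MemLp g 2 (ν.prod (stdNormal d)) →
      Integrable (fun u => g u • κ (reparam m s u)) (ν.prod (stdNormal d)) := fun hg =>
    (hg.integrable (by norm_num)).smul_bdd B hκr (ae_of_all _ fun u => hC _)
  have hgap := memLp_scoreGap hs hL hs0 hp2
  have hop : ∀ i, integralOperator H (densityMeasure (mixture ν m s))
      (fun x => gradLogRatio p (mixture ν m s) x i) =
      ∫ u, scoreGap p m s u i • κ (reparam m s u) ∂(ν.prod (stdNormal d)) := by
    intro i
    have hneg : MemLp (fun u : Z × (Fin d → ℝ) => -(u.2 i / s u.1 i)) 2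
        (ν.prod (stdNormal d)) := (memLp_noise_div hs hL hs0 i).neg
    have i1m : StronglyMeasurable fun x => ∇ (fun x => Real.log (p x)) x i • κ x :=
      (measurable_coord hpc.measurable i).stronglyMeasurable.smul hκ
    have i1 : Integrable (fun x => ∇ (fun x => Real.log (p x)) x i • κ x)
        (densityMeasure (mixture ν m s)) := by
      rw [densityMeasure_mixture hm hs hL hs0]
      refine (integrable_map_measure ?_ hr.aemeasurable).2 (hsm (memLp_coord hp2 i))
      exact i1m.aestronglyMeasurable
    have i2 : Integrable (fun x => (mixturePartial ν m s i x / mixture ν m s x) • κ x)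
        (densityMeasure (mixture ν m s)) := by
      have : IsFiniteMeasure (densityMeasure (mixture ν m s)) := by
        rw [densityMeasure_mixture hm hs hL hs0]; infer_instance
      exact ((memLp_mixturePartial_div hm hs hL hs0 i).integrable (by norm_num)).smul_bdd B
        hκ.aestronglyMeasurable (ae_of_all _ hC)
    simp only [integralOperator, gradLogRatio_mixture hp hpd hm hs hL hs0, sub_smul]
    rw [integral_sub i1 i2, integral_mixturePartial_div_smul hκ hC hm hs hL hs0,
      densityMeasure_mixture hm hs hL hs0, integral_map hr.aemeasurable
        i1m.aestronglyMeasurable,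
      ← integral_sub (hsm (memLp_coord hp2 i)) (hsm hneg)]
    refine integral_congr_ae (ae_of_all _ fun u => ?_)
    simp only [scoreGap, PiLp.add_apply, diagMul_apply, invVec_apply, ← div_eq_mul_inv, add_smul,
      neg_smul, sub_neg_eq_add]
  rw [ksd, integralOperatorNorm, Real.sq_sqrt (by positivity)]
  simp only [hop]
  have hn := fun i => norm_integral_sq_eq (hsm (memLp_coord hgap i))
  simp only [(hn _).2]
  rw [← integral_finsetSum _ fun i _ => (hn i).1]
  refine integral_congr_ae (ae_of_all _ fun u => ?_)
  simp only [inner_smul_left, inner_smul_right, hκdef, inner_kerFun_kerFun H hk, PiLp.inner_apply,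
    Finset.mul_sum]
  refine Finset.sum_congr rfl fun i _ => ?_
  simp
  ring

end Loss

/-! ### The reparametrized samples form a smooth family -/

section Family

variable {d : ℕ}

/-- The inverse of the Riesz isomorphism of a Euclidean space, as a linear isometry. -/
def rieszInv (d : ℕ) : (EuclideanSpace ℝ (Fin d) →L[ℝ] ℝ) →ₗᵢ[ℝ] EuclideanSpace ℝ (Fin d) where
  toFun g := (InnerProductSpace.toDual ℝ (EuclideanSpace ℝ (Fin d))).symm g
  map_add' g h := map_add _ g h
  map_smul' c g := by simp
  norm_map' g := LinearIsometryEquiv.norm_map _ g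

variable {p : EuclideanSpace ℝ (Fin d) → ℝ} {L M : ℝ}

set_option maxSynthPendingDepth 3 in
-- The gradient is the Fréchet derivative composed with the Riesz isometry, so the bounds on the
-- second and third derivatives pass to the score with the same constants.
theorem SmoothTarget.exists_hasFDerivAt_score (h : SmoothTarget p L M) :
    ∃ S' : EuclideanSpace ℝ (Fin d) → EuclideanSpace ℝ (Fin d) →L[ℝ] EuclideanSpace ℝ (Fin d),
      (∀ x, HasFDerivAt (∇ fun x => Real.log (p x)) (S' x) x) ∧ (∀ x, ‖S' x‖ ≤ L) ∧
        ∀ x y, ‖S' x - S' y‖ ≤ M * ‖x - y‖ := by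
  set g := fun x => Real.log (p x) with hg
  have hc1 : ContDiff ℝ 2 (fderiv ℝ g) := h.contDiff.fderiv_right (by norm_num)
  have hc2 : ContDiff ℝ 1 (fderiv ℝ (fderiv ℝ g)) := hc1.fderiv_right (by norm_num)
  have h2 : ∀ x, ‖fderiv ℝ (fderiv ℝ g) x‖ ≤ L := fun x => by
    have := h.bound_two x
    rwa [← norm_iteratedFDeriv_fderiv, ← norm_iteratedFDeriv_fderiv, norm_iteratedFDeriv_zero]
      at this
  have h3 : ∀ x, ‖fderiv ℝ (fderiv ℝ (fderiv ℝ g)) x‖ ≤ M := fun x => by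
    have := h.bound_three x
    rwa [← norm_iteratedFDeriv_fderiv, ← norm_iteratedFDeriv_fderiv, ← norm_iteratedFDeriv_fderiv,
      norm_iteratedFDeriv_zero] at this
  refine ⟨fun x => (rieszInv d).toContinuousLinearMap.comp (fderiv ℝ (fderiv ℝ g) x),
    fun x => ?_, fun x => ?_, fun x y => ?_⟩
  · exact (rieszInv d).toContinuousLinearMap.hasFDerivAt.comp x
      ((hc1.differentiable (by norm_num)) x).hasFDerivAt
  · rw [LinearIsometry.norm_toContinuousLinearMap_comp]
    exact h2 x
  · rw [← ContinuousLinearMap.comp_sub, LinearIsometry.norm_toContinuousLinearMap_comp]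
    exact convex_univ.norm_image_sub_le_of_norm_fderiv_le (𝕜 := ℝ)
      (fun w _ => (hc2.differentiable (by norm_num)) w) (fun w _ => h3 w) (Set.mem_univ _)
      (Set.mem_univ _)

theorem SmoothTarget.score_sub_le (h : SmoothTarget p L M) (x y : EuclideanSpace ℝ (Fin d)) :
    ‖∇ (fun x => Real.log (p x)) x - ∇ (fun x => Real.log (p x)) y‖ ≤ L * ‖x - y‖ := by
  obtain ⟨S', hS, hS1, -⟩ := h.exists_hasFDerivAt_score
  exact convex_univ.norm_image_sub_le_of_norm_hasFDerivWithin_le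
    (fun w _ => (hS w).hasFDerivWithinAt) (fun w _ => hS1 w) (Set.mem_univ _) (Set.mem_univ _)

theorem SmoothTarget.continuous_score (h : SmoothTarget p L M) :
    Continuous (∇ fun x => Real.log (p x)) := by
  obtain ⟨S', hS, -⟩ := h.exists_hasFDerivAt_score
  exact continuous_iff_continuousAt.2 fun x => (hS x).continuousAt

theorem SmoothTarget.nonneg_three (h : SmoothTarget p L M) : 0 ≤ M :=
  (norm_nonneg _).trans (h.bound_three 0)

theorem diagMul_sub (ξ η : Fin d → ℝ) : diagMul ξ - diagMul η = diagMul (ξ - η) := by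
  ext v i
  simp [sub_mul]

variable {V : Type*} [NormedAddCommGroup V] [NormedSpace ℝ V]

theorem hasFDerivAt_diagMul_invVec {σ : V → EuclideanSpace ℝ (Fin d)}
    {σ' : V →L[ℝ] EuclideanSpace ℝ (Fin d)} {φ : V} (h : HasFDerivAt σ σ' φ)
    (h0 : ∀ i, σ φ i ≠ 0) (ξ : Fin d → ℝ) :
    HasFDerivAt (fun φ => diagMul ξ (invVec (σ φ)))
      (-(diagMul fun i => ξ i * (σ φ i ^ 2)⁻¹).comp σ') φ := by
  rw [← hasFDerivWithinAt_univ, hasFDerivWithinAt_euclidean]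
  intro i
  rw [hasFDerivWithinAt_univ]
  have h1 := hasFDerivWithinAt_univ.1 (hasFDerivWithinAt_euclidean.1 h.hasFDerivWithinAt i)
  have h2 := ((hasDerivAt_inv (h0 i)).comp_hasFDerivAt φ h1).const_mul (ξ i)
  refine h2.congr_fderiv ?_
  ext v
  simp [mul_assoc]

/-- Factor the difference as s⁻¹t⁻¹(s⁻¹ + t⁻¹)(t - s), with inverses at most √L. This produces the
`L * √L` in the constant of the family. -/
theorem abs_inv_sq_sub_inv_sq_le (hL : 0 < L) {s t : ℝ} (hs : 1 / √L ≤ s) (ht : 1 / √L ≤ t) :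
    |(s ^ 2)⁻¹ - (t ^ 2)⁻¹| ≤ 2 * (L * √L) * |s - t| := by
  have hL' := Real.sqrt_pos.2 hL
  have hs0 : 0 < s := (by positivity : 0 < 1 / √L).trans_le hs
  have ht0 : 0 < t := (by positivity : 0 < 1 / √L).trans_le ht
  have h1 := inv_le_sqrt hL hs
  have h2 := inv_le_sqrt hL ht
  have h3 : (s ^ 2)⁻¹ - (t ^ 2)⁻¹ = -(s⁻¹ * t⁻¹ * (s⁻¹ + t⁻¹) * (s - t)) := by
    field_simp
    ring
  have h4 : 0 ≤ s⁻¹ * t⁻¹ * (s⁻¹ + t⁻¹) := by positivity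
  rw [h3, abs_neg, abs_mul, abs_of_nonneg h4]
  refine mul_le_mul_of_nonneg_right ?_ (abs_nonneg _)
  calc s⁻¹ * t⁻¹ * (s⁻¹ + t⁻¹) ≤ √L * √L * (√L + √L) := by gcongr
    _ = 2 * (L * √L) := by rw [Real.mul_self_sqrt hL.le]; ring

theorem inv_sq_le (hL : 0 < L) {s : ℝ} (hs : 1 / √L ≤ s) : (s ^ 2)⁻¹ ≤ L := by
  have hL' := Real.sqrt_pos.2 hL
  have hs0 : 0 < s := (by positivity : 0 < 1 / √L).trans_le hs
  have h1 := inv_le_sqrt hL hs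
  calc (s ^ 2)⁻¹ = s⁻¹ ^ 2 := by rw [inv_pow]
    _ ≤ √L ^ 2 := by gcongr
    _ = L := Real.sq_sqrt hL.le

variable {dz m : ℕ} {Φ : Set (EuclideanSpace ℝ (Fin m))}
  {μ σ : EuclideanSpace ℝ (Fin dz) → EuclideanSpace ℝ (Fin m) → EuclideanSpace ℝ (Fin d)} {G : ℝ}

theorem NetworkGrowth.hasFDerivAt {μ : EuclideanSpace ℝ (Fin dz) → EuclideanSpace ℝ (Fin m) →
    EuclideanSpace ℝ (Fin d)} (h : NetworkGrowth Φ μ G) (hΦo : IsOpen Φ)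
    (z : EuclideanSpace ℝ (Fin dz)) {φ : EuclideanSpace ℝ (Fin m)} (hφ : φ ∈ Φ) :
    HasFDerivAt (μ z) (fderiv ℝ (μ z) φ) φ :=
  ((h.differentiableOn z).differentiableAt (hΦo.mem_nhds hφ)).hasFDerivAt

theorem NetworkGrowth.sub_le (h : NetworkGrowth Φ μ G) (hΦo : IsOpen Φ) (hΦ : Convex ℝ Φ)
    (z : EuclideanSpace ℝ (Fin dz)) {φ ψ : EuclideanSpace ℝ (Fin m)} (hφ : φ ∈ Φ) (hψ : ψ ∈ Φ) :
    ‖μ z φ - μ z ψ‖ ≤ G * (1 + ‖z‖) * ‖φ - ψ‖ :=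
  hΦ.norm_image_sub_le_of_norm_hasFDerivWithin_le
    (fun _ hw => (h.hasFDerivAt hΦo z hw).hasFDerivWithinAt) (h.bound_one z) hψ hφ

theorem NetworkGrowth.fderiv_sub_le (h : NetworkGrowth Φ μ G) (hΦo : IsOpen Φ) (hΦ : Convex ℝ Φ)
    (z : EuclideanSpace ℝ (Fin dz)) {φ ψ : EuclideanSpace ℝ (Fin m)} (hφ : φ ∈ Φ) (hψ : ψ ∈ Φ) :
    ‖fderiv ℝ (μ z) φ - fderiv ℝ (μ z) ψ‖ ≤ G * (1 + ‖z‖) * ‖φ - ψ‖ :=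
  hΦ.norm_image_sub_le_of_norm_fderiv_le (𝕜 := ℝ)
    (fun _ hw => (h.differentiableOn_fderiv z).differentiableAt (hΦo.mem_nhds hw))
    (h.bound_two z) hψ hφ

/-- The envelope that controls the derivatives of the reparametrized samples. -/
def envelope (G : ℝ) (u : EuclideanSpace ℝ (Fin dz) × (Fin d → ℝ)) : ℝ :=
  G * (1 + ‖u.1‖) * (1 + ‖u.2‖)

/-- The derivative of `f` is S'(X)X' - Jσ', where S' is the Hessian of log p and J is diagonal with
entries ξ_i/σ_i². Variation of S' costs M, variation of J costs 2L√L, and variation of X' and σ'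
costs L each; 2L in place of 4L would already suffice. -/
theorem smoothFamily_reparam (hΦo : IsOpen Φ) (hΦ : Convex ℝ Φ) (hL : 0 < L) (hG : 1 ≤ G)
    (hp : SmoothTarget p L M) (hμ : NetworkGrowth Φ μ G) (hσ : NetworkGrowth Φ σ G)
    (hσL : ∀ z, ∀ φ ∈ Φ, ∀ i, 1 / √L ≤ σ z φ i) :
    ∃ x' f', SmoothFamily Φ (fun u φ => reparam (fun z => μ z φ) (fun z => σ z φ) u)
      (fun u φ => scoreGap p (fun z => μ z φ) (fun z => σ z φ) u) x' f' (envelope G)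
      (M + 4 * L + 2 * (L * √L)) := by
  obtain ⟨S', hS, hS1, hS2⟩ := hp.exists_hasFDerivAt_score
  have hM := hp.nonneg_three
  have hL' := Real.sqrt_pos.2 hL
  set x' : EuclideanSpace ℝ (Fin dz) × (Fin d → ℝ) → EuclideanSpace ℝ (Fin m) →
      EuclideanSpace ℝ (Fin m) →L[ℝ] EuclideanSpace ℝ (Fin d) := fun u φ =>
    fderiv ℝ (μ u.1) φ + (diagMul u.2).comp (fderiv ℝ (σ u.1) φ) with hx'
  set J : EuclideanSpace ℝ (Fin dz) × (Fin d → ℝ) → EuclideanSpace ℝ (Fin m) →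
      EuclideanSpace ℝ (Fin d) →L[ℝ] EuclideanSpace ℝ (Fin d) := fun u φ =>
    diagMul fun i => u.2 i * (σ u.1 φ i ^ 2)⁻¹ with hJ
  set x : EuclideanSpace ℝ (Fin dz) × (Fin d → ℝ) → EuclideanSpace ℝ (Fin m) →
      EuclideanSpace ℝ (Fin d) := fun u φ => reparam (fun z => μ z φ) (fun z => σ z φ) u with hx
  have hg1 : ∀ z : EuclideanSpace ℝ (Fin dz), 1 ≤ G * (1 + ‖z‖) := fun z => by
    nlinarith [norm_nonneg z]
  have hD : ∀ ξ : Fin d → ℝ, ‖diagMul ξ‖ ≤ ‖ξ‖ := fun ξ =>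
    norm_diagMul_le (norm_nonneg _) fun i => norm_le_pi_norm ξ i
  have hxd : ∀ u, ∀ φ ∈ Φ, HasFDerivAt (x u) (x' u φ) φ := fun u φ hφ =>
    (hμ.hasFDerivAt hΦo u.1 hφ).add
      ((diagMul u.2).hasFDerivAt.comp φ (hσ.hasFDerivAt hΦo u.1 hφ))
  have hxb : ∀ u, ∀ φ ∈ Φ, ‖x' u φ‖ ≤ envelope G u := fun u φ hφ => by
    refine (norm_add_le_of_le (hμ.bound_one u.1 φ hφ)
      ((ContinuousLinearMap.opNorm_comp_le _ _).trans (mul_le_mul (hD u.2)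
        (hσ.bound_one u.1 φ hφ) (norm_nonneg _) (norm_nonneg _)))).trans (le_of_eq ?_)
    rw [envelope]; ring
  have hxl : ∀ u, ∀ φ ∈ Φ, ∀ ψ ∈ Φ, ‖x' u φ - x' u ψ‖ ≤ envelope G u * ‖φ - ψ‖ := by
    intro u φ hφ ψ hψ
    have : x' u φ - x' u ψ = (fderiv ℝ (μ u.1) φ - fderiv ℝ (μ u.1) ψ) +
        (diagMul u.2).comp (fderiv ℝ (σ u.1) φ - fderiv ℝ (σ u.1) ψ) := by
      simp only [hx', ContinuousLinearMap.comp_sub]; abel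
    rw [this]
    refine (norm_add_le_of_le (hμ.fderiv_sub_le hΦo hΦ u.1 hφ hψ)
      ((ContinuousLinearMap.opNorm_comp_le _ _).trans (mul_le_mul (hD u.2)
        (hσ.fderiv_sub_le hΦo hΦ u.1 hφ hψ) (norm_nonneg _) (norm_nonneg _)))).trans (le_of_eq ?_)
    rw [envelope]; ring
  have hxs : ∀ u, ∀ φ ∈ Φ, ∀ ψ ∈ Φ, ‖x u φ - x u ψ‖ ≤ envelope G u * ‖φ - ψ‖ :=
    fun u φ hφ ψ hψ => hΦ.norm_image_sub_le_of_norm_hasFDerivWithin_le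
      (fun w hw => (hxd u w hw).hasFDerivWithinAt) (hxb u) hψ hφ
  have hσ0 : ∀ z, ∀ φ ∈ Φ, ∀ i, 0 < σ z φ i := fun z φ hφ i =>
    (by positivity : 0 < 1 / √L).trans_le (hσL z φ hφ i)
  have hJb : ∀ u, ∀ φ ∈ Φ, ‖J u φ‖ ≤ ‖u.2‖ * L := fun u φ hφ =>
    norm_diagMul_le (by positivity) fun i => by
      have := inv_sq_le hL (hσL u.1 φ hφ i)
      rw [abs_mul, abs_of_nonneg (a := (σ u.1 φ i ^ 2)⁻¹) (by positivity)]
      exact mul_le_mul (norm_le_pi_norm u.2 i) this (by positivity) (norm_nonneg _)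
  have hJl : ∀ u, ∀ φ ∈ Φ, ∀ ψ ∈ Φ, ‖J u φ - J u ψ‖ ≤
      ‖u.2‖ * (2 * (L * √L) * (G * (1 + ‖u.1‖) * ‖φ - ψ‖)) := by
    intro u φ hφ ψ hψ
    rw [hJ, diagMul_sub]
    have hs := hσ.sub_le hΦo hΦ u.1 hφ hψ
    refine norm_diagMul_le (by positivity) fun i => ?_
    rw [Pi.sub_apply, ← mul_sub, abs_mul]
    refine mul_le_mul (norm_le_pi_norm u.2 i) ((abs_inv_sq_sub_inv_sq_le hL (hσL u.1 φ hφ i)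
      (hσL u.1 ψ hψ i)).trans ?_) (abs_nonneg _) (norm_nonneg _)
    gcongr
    refine le_trans ?_ hs
    have := PiLp.norm_apply_le (σ u.1 φ - σ u.1 ψ) i
    simpa using this
  have henv : ∀ u : EuclideanSpace ℝ (Fin dz) × (Fin d → ℝ), 1 ≤ envelope G u := fun u => by
    have := hg1 u.1
    rw [envelope]
    nlinarith [norm_nonneg u.2]
  refine ⟨x', fun u φ => (S' (x u φ)).comp (x' u φ) - (J u φ).comp (fderiv ℝ (σ u.1) φ),
    ⟨henv, by positivity, hxd, fun u φ hφ => ?_, hxb, fun u φ hφ => ?_, hxl,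
      fun u φ hφ ψ hψ => ?_⟩⟩
  · rw [sub_eq_add_neg]
    refine ((hS (x u φ)).comp φ (hxd u φ hφ)).add ?_
    exact hasFDerivAt_diagMul_invVec (hσ.hasFDerivAt hΦo u.1 hφ)
      (fun i => (hσ0 u.1 φ hφ i).ne') u.2
  · have hn := norm_nonneg u.2
    have hg := hg1 u.1
    have h1 := (ContinuousLinearMap.opNorm_comp_le (S' (x u φ)) (x' u φ)).trans
      (mul_le_mul (hS1 _) (hxb u φ hφ) (norm_nonneg _) hL.le)
    have h2 := (ContinuousLinearMap.opNorm_comp_le (J u φ) (fderiv ℝ (σ u.1) φ)).trans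
      (mul_le_mul (hJb u φ hφ) (hσ.bound_one u.1 φ hφ) (norm_nonneg _) (by positivity))
    have h3 : ‖u.2‖ * L * (G * (1 + ‖u.1‖)) ≤ L * envelope G u := by
      rw [envelope]
      nlinarith [mul_pos hL (zero_lt_one.trans_le hg)]
    have h4 : 0 ≤ (M + 2 * (L * √L) + 2 * L) * envelope G u := by
      have := henv u
      positivity
    refine (norm_sub_le_of_le h1 (h2.trans h3)).trans ?_
    nlinarith
  · have hn := norm_nonneg u.2
    have hg := hg1 u.1
    have he := henv u
    have hΔ := norm_nonneg (φ - ψ)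
    have key : (S' (x u φ)).comp (x' u φ) - (J u φ).comp (fderiv ℝ (σ u.1) φ) -
        ((S' (x u ψ)).comp (x' u ψ) - (J u ψ).comp (fderiv ℝ (σ u.1) ψ)) =
        (S' (x u φ) - S' (x u ψ)).comp (x' u φ) + (S' (x u ψ)).comp (x' u φ - x' u ψ) -
        ((J u φ - J u ψ).comp (fderiv ℝ (σ u.1) φ) +
          (J u ψ).comp (fderiv ℝ (σ u.1) φ - fderiv ℝ (σ u.1) ψ)) := by
      simp only [ContinuousLinearMap.sub_comp, ContinuousLinearMap.comp_sub]
      abel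
    have h1 := (ContinuousLinearMap.opNorm_comp_le (S' (x u φ) - S' (x u ψ)) (x' u φ)).trans
      (mul_le_mul ((hS2 _ _).trans (mul_le_mul_of_nonneg_left (hxs u φ hφ ψ hψ) hM))
        (hxb u φ hφ) (norm_nonneg _) (by positivity))
    have h2 := (ContinuousLinearMap.opNorm_comp_le (S' (x u ψ)) (x' u φ - x' u ψ)).trans
      (mul_le_mul (hS1 _) (hxl u φ hφ ψ hψ) (norm_nonneg _) hL.le)
    have h3 := (ContinuousLinearMap.opNorm_comp_le (J u φ - J u ψ) (fderiv ℝ (σ u.1) φ)).trans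
      (mul_le_mul (hJl u φ hφ ψ hψ) (hσ.bound_one u.1 φ hφ) (norm_nonneg _) (by positivity))
    have h4 := (ContinuousLinearMap.opNorm_comp_le (J u ψ)
      (fderiv ℝ (σ u.1) φ - fderiv ℝ (σ u.1) ψ)).trans
      (mul_le_mul (hJb u ψ hψ) (hσ.fderiv_sub_le hΦo hΦ u.1 hφ hψ) (norm_nonneg _)
        (by positivity))
    rw [key]
    refine (norm_sub_le_of_le (norm_add_le_of_le h1 h2) (norm_add_le_of_le h3 h4)).trans ?_
    set g := G * (1 + ‖u.1‖)
    set n := ‖u.2‖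
    set Δ := ‖φ - ψ‖
    have hb : envelope G u = g * (1 + n) := rfl
    set b := envelope G u
    have e1 : b ≤ b ^ 2 := by nlinarith
    have e2 : n * g ≤ b ^ 2 := by nlinarith
    -- The term where J varies contains the growth of σ twice but the noise once; this and the
    -- Hessian term, quadratic in the envelope, are why the Lipschitz bound carries b² and not b.
    have e3 : n * g ^ 2 ≤ b ^ 2 := by
      rw [hb]
      nlinarith [sq_nonneg g, mul_nonneg (sq_nonneg g) hn,
        mul_nonneg (sq_nonneg g) (sq_nonneg n)]
    calc M * (b * Δ) * b + L * (b * Δ) + (n * (2 * (L * √L) * (g * Δ)) * g + n * L * (g * Δ))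
        = (M * b ^ 2 + L * b + 2 * (L * √L) * (n * g ^ 2) + L * (n * g)) * Δ := by ring
      _ ≤ (M * b ^ 2 + L * b ^ 2 + 2 * (L * √L) * b ^ 2 + L * b ^ 2) * Δ := by gcongr
      _ ≤ (M * b ^ 2 + L * b ^ 2 + 2 * (L * √L) * b ^ 2 + L * b ^ 2) * Δ + 2 * L * b ^ 2 * Δ :=
        le_add_of_nonneg_right (by positivity)
      _ = _ := by ring

end Family

/-! ### Moment bounds -/

section Moments

theorem integrable_pow_four_of_lintegral_le {Ω E : Type*} [MeasurableSpace Ω] {P : Measure Ω}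
    [NormedAddCommGroup E] {g : Ω → E} (hg : AEStronglyMeasurable g P) {c : ℝ} (hc : 0 ≤ c)
    (h : ∫⁻ ω, ‖g ω‖ₑ ^ 4 ∂P ≤ ENNReal.ofReal c) :
    Integrable (fun ω => ‖g ω‖ ^ 4) P ∧ ∫ ω, ‖g ω‖ ^ 4 ∂P ≤ c := by
  have h1 : ∀ ω, ENNReal.ofReal (‖g ω‖ ^ 4) = ‖g ω‖ₑ ^ 4 := fun ω => by
    rw [ENNReal.ofReal_pow (norm_nonneg _), ofReal_norm]
  have hm : AEStronglyMeasurable (fun ω => ‖g ω‖ ^ 4) P := hg.norm.pow 4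
  have hi : Integrable (fun ω => ‖g ω‖ ^ 4) P := by
    refine ⟨hm, ?_⟩
    rw [hasFiniteIntegral_iff_ofReal (ae_of_all _ fun ω => by positivity)]
    simp only [h1]
    exact h.trans_lt ENNReal.ofReal_lt_top
  refine ⟨hi, ?_⟩
  rw [integral_eq_lintegral_of_nonneg_ae (ae_of_all _ fun ω => by positivity) hm]
  simp only [h1]
  exact ENNReal.toReal_le_of_le_ofReal hc h

theorem one_add_pow_four_le (t : ℝ) : (1 + t) ^ 4 ≤ 8 * (1 + t ^ 4) := by
  nlinarith [sq_nonneg (t - 1), sq_nonneg (t ^ 2 - 1), sq_nonneg (t ^ 2 - t)]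

/-- The weight halves the Gaussian exponent, so a Gaussian integral remains; its exact value is √2.
-/
theorem integral_exp_sq_div_four_gaussianReal :
    Integrable (fun t => Real.exp (t ^ 2 / 4)) (gaussianReal 0 1) ∧
      ∫ t, Real.exp (t ^ 2 / 4) ∂gaussianReal 0 1 ≤ 2 := by
  have h1 : ∀ t : ℝ, gaussianPDFReal 0 1 t * Real.exp (t ^ 2 / 4) =
      (√(2 * Real.pi))⁻¹ * Real.exp (-(1 / 4) * t ^ 2) := fun t => by
    rw [gaussianPDFReal]
    simp only [NNReal.coe_one, mul_one, sub_zero]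
    rw [mul_assoc, ← Real.exp_add]
    congr 2
    ring
  have hpi : 0 < √(2 * Real.pi) := Real.sqrt_pos.2 (by positivity)
  refine ⟨?_, ?_⟩
  · rw [gaussianReal_of_var_ne_zero _ one_ne_zero, integrable_withDensity_iff_integrable_smul'
      (measurable_gaussianPDF _ _) (ae_of_all _ fun _ => gaussianPDF_lt_top)]
    simp only [toReal_gaussianPDF, smul_eq_mul, h1]
    exact (integrable_exp_neg_mul_sq (by norm_num)).const_mul _
  · rw [integral_gaussianReal_eq_integral_smul one_ne_zero]
    simp only [smul_eq_mul, h1]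
    rw [integral_const_mul, integral_gaussian, inv_mul_le_iff₀ hpi,
      Real.sqrt_le_left (by positivity), mul_pow, Real.sq_sqrt (by positivity)]
    nlinarith [Real.pi_pos]

/-- Below log d the first term suffices. Above it, with r = t - log d, one has t² ≤ 2 log² d + 2r²
and r²/2 ≤ exp(r) = exp(t)/d. The factor 1/d later pays for a sum over d coordinates. -/
theorem sq_le_log_sq_add {d : ℕ} (hd : 1 ≤ d) {t : ℝ} (ht : 0 ≤ t) :
    t ^ 2 ≤ 2 * Real.log d ^ 2 + 4 / d * Real.exp t := by
  have hd0 : (0 : ℝ) < d := by exact_mod_cast hd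
  have hl : 0 ≤ Real.log d := Real.log_nonneg (by exact_mod_cast hd)
  rcases le_total t (Real.log d) with h | h
  · have : 0 ≤ 4 / d * Real.exp t := by positivity
    nlinarith
  · have h1 := Real.quadratic_le_exp_of_nonneg (sub_nonneg.2 h)
    rw [Real.exp_sub, Real.exp_log hd0] at h1
    have h2 : 4 / d * Real.exp t = 4 * (Real.exp t / d) := by ring
    rw [h2]
    nlinarith [sq_nonneg (t - Real.log d - Real.log d), sq_nonneg (t - 2 * Real.log d)]

/-- The maximum of `d` standard Gaussians has moments of logarithmic growth. -/
theorem integral_one_add_norm_pow_four_stdNormal {d : ℕ} (hd : 2 ≤ d) :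
    Integrable (fun ξ : Fin d → ℝ => (1 + ‖ξ‖) ^ 4) (stdNormal d) ∧
      ∫ ξ, (1 + ‖ξ‖) ^ 4 ∂stdNormal d ≤ 2500 * Real.log d ^ 2 := by
  have hd0 : (0 : ℝ) < d := by exact_mod_cast (by omega : 0 < d)
  have hne : Nonempty (Fin d) := ⟨⟨0, by omega⟩⟩
  -- Since d ≥ 2, additive constants can be absorbed into log² d: the final bound is 1032 + 256 log²
  -- d ≤ 2500 log² d.
  have hl2 : 0.69 ≤ Real.log d :=
    (by linarith [Real.log_two_gt_d9] : (0.69 : ℝ) ≤ Real.log 2).trans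
      (Real.log_le_log (by norm_num) (by exact_mod_cast hd))
  have hev : ∀ i : Fin d, MeasurePreserving (fun ξ : Fin d → ℝ => ξ i) (stdNormal d)
      (gaussianReal 0 1) := fun i => measurePreserving_eval (fun _ : Fin d => gaussianReal 0 1) i
  have hi : ∀ i : Fin d, Integrable (fun ξ : Fin d → ℝ => Real.exp (ξ i ^ 2 / 4)) (stdNormal d) :=
    fun i => (hev i).integrable_comp_of_integrable integral_exp_sq_div_four_gaussianReal.1
  have hE : ∀ i : Fin d, ∫ ξ, Real.exp (ξ i ^ 2 / 4) ∂stdNormal d ≤ 2 := fun i => by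
    have h1 := integral_map (μ := stdNormal d) (φ := fun ξ : Fin d → ℝ => ξ i)
      (f := fun t => Real.exp (t ^ 2 / 4)) (hev i).measurable.aemeasurable
      (by fun_prop)
    rw [(hev i).map_eq] at h1
    rw [← h1]
    exact integral_exp_sq_div_four_gaussianReal.2
  -- The sup norm is attained at one coordinate, whose exponential is at most the sum over all
  -- coordinates.
  have hpt : ∀ ξ : Fin d → ℝ, (1 + ‖ξ‖) ^ 4 ≤
      8 * (1 + 16 * (2 * Real.log d ^ 2 + 4 / d * ∑ i, Real.exp (ξ i ^ 2 / 4))) := by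
    intro ξ
    refine (one_add_pow_four_le ‖ξ‖).trans ?_
    obtain ⟨i, hi⟩ : ∃ i, ‖ξ‖ = ‖ξ i‖ := by
      obtain ⟨i, -, hi⟩ := Finset.exists_max_image Finset.univ (fun i => ‖ξ i‖)
        Finset.univ_nonempty
      exact ⟨i, le_antisymm ((pi_norm_le_iff_of_nonneg (norm_nonneg _)).2 fun j =>
        hi j (Finset.mem_univ j)) (norm_le_pi_norm ξ i)⟩
    have h1 : ‖ξ‖ ^ 4 = 16 * (ξ i ^ 2 / 4) ^ 2 := by
      rw [hi, Real.norm_eq_abs]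
      have : |ξ i| ^ 4 = (|ξ i| ^ 2) ^ 2 := by ring
      rw [this, sq_abs]; ring
    have h2 := sq_le_log_sq_add (d := d) (by omega) (t := ξ i ^ 2 / 4) (by positivity)
    have h3 : Real.exp (ξ i ^ 2 / 4) ≤ ∑ i, Real.exp (ξ i ^ 2 / 4) :=
      Finset.single_le_sum (f := fun i => Real.exp (ξ i ^ 2 / 4))
        (fun _ _ => (Real.exp_pos _).le) (Finset.mem_univ i)
    rw [h1]
    gcongr
    exact h2.trans (by gcongr)
  have hSi : Integrable (fun ξ : Fin d → ℝ => ∑ i, Real.exp (ξ i ^ 2 / 4)) (stdNormal d) :=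
    integrable_finsetSum _ fun i _ => hi i
  have hT : Integrable (fun ξ : Fin d → ℝ => 2 * Real.log d ^ 2 +
      4 / d * ∑ i, Real.exp (ξ i ^ 2 / 4)) (stdNormal d) :=
    (integrable_const _).add (hSi.const_mul _)
  have hB : Integrable (fun ξ : Fin d → ℝ => 8 * (1 + 16 * (2 * Real.log d ^ 2 +
      4 / d * ∑ i, Real.exp (ξ i ^ 2 / 4)))) (stdNormal d) :=
    ((integrable_const _).add (hT.const_mul _)).const_mul _
  have hmeas : AEStronglyMeasurable (fun ξ : Fin d → ℝ => (1 + ‖ξ‖) ^ 4) (stdNormal d) :=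
    (by fun_prop : Continuous fun ξ : Fin d → ℝ => (1 + ‖ξ‖) ^ 4).aestronglyMeasurable
  have hint : Integrable (fun ξ : Fin d → ℝ => (1 + ‖ξ‖) ^ 4) (stdNormal d) :=
    hB.mono' hmeas (ae_of_all _ fun ξ => by
      rw [Real.norm_of_nonneg (by positivity)]; exact hpt ξ)
  refine ⟨hint, (integral_mono hint hB hpt).trans ?_⟩
  have hS : ∫ ξ, ∑ i, Real.exp (ξ i ^ 2 / 4) ∂stdNormal d ≤ d * 2 := by
    rw [integral_finsetSum _ fun i _ => hi i]
    refine (Finset.sum_le_sum fun i _ => hE i).trans ?_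
    simp
  have hval : ∫ ξ : Fin d → ℝ, 8 * (1 + 16 * (2 * Real.log d ^ 2 +
      4 / d * ∑ i, Real.exp (ξ i ^ 2 / 4))) ∂stdNormal d =
      8 * (1 + 16 * (2 * Real.log d ^ 2 +
        4 / d * ∫ ξ, ∑ i, Real.exp (ξ i ^ 2 / 4) ∂stdNormal d)) := by
    rw [integral_const_mul, integral_add (integrable_const _) (hT.const_mul _), integral_const_mul,
      integral_add (integrable_const _) (hSi.const_mul _), integral_const_mul (4 / (d : ℝ))]
    simp
  rw [hval]
  have h4 : 4 / (d : ℝ) * ∫ ξ, ∑ i, Real.exp (ξ i ^ 2 / 4) ∂stdNormal d ≤ 8 := by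
    calc _ ≤ 4 / (d : ℝ) * (d * 2) := by gcongr
      _ = 8 := by field_simp; norm_num
  nlinarith

theorem integral_noise_sq {d : ℕ} (i : Fin d) : ∫ ξ : Fin d → ℝ, ξ i ^ 2 ∂stdNormal d = 1 := by
  have hev : MeasurePreserving (fun ξ : Fin d → ℝ => ξ i) (stdNormal d)
      (gaussianReal 0 1) := measurePreserving_eval (fun _ : Fin d => gaussianReal 0 1) i
  have h1 := integral_map (μ := stdNormal d) (φ := fun ξ : Fin d → ℝ => ξ i)
    (f := fun t => t ^ 2) hev.measurable.aemeasurable (by fun_prop)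
  rw [hev.map_eq] at h1
  rw [← h1]
  have h2 := variance_fun_id_gaussianReal (μ := 0) (v := 1)
  rw [variance_of_integral_eq_zero (by fun_prop) (by simp)] at h2
  simpa using h2

variable {dz d : ℕ}

/-- The mixing variable and the noise are independent, so the fourth moment factors: one factor is
of order d_z², the other of order log² d. -/
theorem integral_envelope_pow_four_le {ν : Measure (EuclideanSpace ℝ (Fin dz))}
    [IsProbabilityMeasure ν] {a G : ℝ} (ha : 0 ≤ a) (hG : 1 ≤ G) (hdz : 1 ≤ dz) (hd : 2 ≤ d)
    (hν : ∫⁻ z, ‖z‖ₑ ^ 4 ∂ν ≤ ENNReal.ofReal (a * (dz : ℝ) ^ 2)) :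
    MemLp (fun u : EuclideanSpace ℝ (Fin dz) × (Fin d → ℝ) => envelope G u ^ 2) 2
      (ν.prod (stdNormal d)) ∧
    ∫ u : EuclideanSpace ℝ (Fin dz) × (Fin d → ℝ), (envelope G u ^ 2) ^ 2
      ∂(ν.prod (stdNormal d)) ≤ (150 * (1 + a) * (G ^ 2 * dz * Real.log d)) ^ 2 := by
  obtain ⟨h1, h2⟩ := integrable_pow_four_of_lintegral_le
    (g := fun z : EuclideanSpace ℝ (Fin dz) => z) aestronglyMeasurable_id (by positivity) hν
  obtain ⟨h3, h4⟩ := integral_one_add_norm_pow_four_stdNormal hd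
  have hdz' : (1 : ℝ) ≤ dz := by exact_mod_cast hdz
  have hB : Integrable (fun z : EuclideanSpace ℝ (Fin dz) => 8 * (1 + ‖z‖ ^ 4)) ν :=
    ((integrable_const _).add h1).const_mul 8
  have h5 : Integrable (fun z : EuclideanSpace ℝ (Fin dz) => (1 + ‖z‖) ^ 4) ν := by
    refine hB.mono' ?_ (ae_of_all _ fun z => ?_)
    · exact (by fun_prop : Continuous fun z : EuclideanSpace ℝ (Fin dz) =>
        (1 + ‖z‖) ^ 4).aestronglyMeasurable
    · rw [Real.norm_of_nonneg (by positivity)]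
      exact one_add_pow_four_le ‖z‖
  have h6 : ∫ z, (1 + ‖z‖) ^ 4 ∂ν ≤ 8 * (1 + a) * (dz : ℝ) ^ 2 := by
    have : ∫ z : EuclideanSpace ℝ (Fin dz), 8 * (1 + ‖z‖ ^ 4) ∂ν =
        8 * (1 + ∫ z : EuclideanSpace ℝ (Fin dz), ‖z‖ ^ 4 ∂ν) := by
      rw [integral_const_mul, integral_add (integrable_const _) h1]
      simp
    refine (integral_mono h5 hB fun z =>
      one_add_pow_four_le ‖z‖).trans (this.trans_le ?_)
    nlinarith
  have hpow : ∀ u : EuclideanSpace ℝ (Fin dz) × (Fin d → ℝ), (envelope G u ^ 2) ^ 2 =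
      G ^ 4 * ((1 + ‖u.1‖) ^ 4 * (1 + ‖u.2‖) ^ 4) := fun u => by
    rw [envelope]; ring
  have hc : Continuous fun u : EuclideanSpace ℝ (Fin dz) × (Fin d → ℝ) => envelope G u ^ 2 := by
    unfold envelope; fun_prop
  refine ⟨?_, ?_⟩
  · rw [memLp_two_iff_integrable_sq hc.aestronglyMeasurable]
    simp only [hpow]
    exact (h5.mul_prod h3).const_mul _
  · simp only [hpow]
    rw [integral_const_mul, integral_prod_mul (fun z : EuclideanSpace ℝ (Fin dz) => (1 + ‖z‖) ^ 4)
      (fun ξ : Fin d → ℝ => (1 + ‖ξ‖) ^ 4)]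
    have h7 : 0 ≤ ∫ ξ : Fin d → ℝ, (1 + ‖ξ‖) ^ 4 ∂stdNormal d :=
      integral_nonneg fun ξ => by positivity
    calc G ^ 4 * ((∫ z, (1 + ‖z‖) ^ 4 ∂ν) * ∫ ξ : Fin d → ℝ, (1 + ‖ξ‖) ^ 4 ∂stdNormal d)
        ≤ G ^ 4 * ((8 * (1 + a) * (dz : ℝ) ^ 2) * (2500 * Real.log d ^ 2)) := by gcongr
      _ = 20000 * (1 + a) * (G ^ 4 * dz ^ 2 * Real.log d ^ 2) := by ring
      -- Rounds 8 · 2500 up to 150² and squares 1 + a, so that the bound is a perfect square.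
      _ ≤ 22500 * (1 + a) ^ 2 * (G ^ 4 * dz ^ 2 * Real.log d ^ 2) := by
        gcongr ?_ * _
        nlinarith
      _ = _ := by ring

variable {Z : Type*} [MeasurableSpace Z] {m s : Z → EuclideanSpace ℝ (Fin d)}
  {ν : Measure Z} [IsProbabilityMeasure ν] {p : EuclideanSpace ℝ (Fin d) → ℝ} {L M r : ℝ}

/-- The score is L-Lipschitz and vanishes at `xstar`, so it grows at most linearly; its second
moment is controlled by that of the sample, which Cauchy–Schwarz bounds by r². -/
theorem memLp_score_reparam (hp : SmoothTarget p L M) (hm : Measurable m) (hs : Measurable s)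
    (hL : 0 < L) (hs0 : ∀ z i, 1 / √L ≤ s z i)
    (hr : ∫⁻ x, ‖x‖ₑ ^ 4 ∂(densityMeasure (mixture ν m s)) ≤ ENNReal.ofReal (r ^ 4))
    {xstar : EuclideanSpace ℝ (Fin d)} (hx : ∇ (fun x => Real.log (p x)) xstar = 0) :
    MemLp (fun u => ∇ (fun x => Real.log (p x)) (reparam m s u)) 2 (ν.prod (stdNormal d)) ∧
    ∫ u, ‖∇ (fun x => Real.log (p x)) (reparam m s u)‖ ^ 2 ∂(ν.prod (stdNormal d)) ≤
      4 * √(L ^ 4 * (r ^ 4 + ‖xstar‖ ^ 4)) := by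
  have hX := measurable_reparam hm hs
  rw [densityMeasure_mixture hm hs hL hs0, lintegral_map (by fun_prop) hX] at hr
  obtain ⟨h1, h2⟩ := integrable_pow_four_of_lintegral_le hX.aestronglyMeasurable
    (by positivity) hr
  have hX2 : AEStronglyMeasurable (fun u => ‖reparam m s u‖ ^ 2) (ν.prod (stdNormal d)) :=
    (hX.norm.pow_const 2).aestronglyMeasurable
  have h3 : MemLp (fun u => ‖reparam m s u‖ ^ 2) 2 (ν.prod (stdNormal d)) := by
    rw [memLp_two_iff_integrable_sq hX2]
    exact h1.congr (ae_of_all _ fun u => by ring)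
  have h4 : Integrable (fun u => ‖reparam m s u‖ ^ 2) (ν.prod (stdNormal d)) :=
    h3.integrable (by norm_num)
  have h5 : ∫ u, ‖reparam m s u‖ ^ 2 ∂(ν.prod (stdNormal d)) ≤ r ^ 2 := by
    have := integral_mul_le_of_integral_sq_le (h := fun _ => 1) h3 (memLp_const (1 : ℝ))
      (fun u => by positivity) (fun u => zero_le_one) (sq_nonneg r) zero_le_one
      (le_trans (le_of_eq (integral_congr_ae (ae_of_all _ fun u => by ring)))
        (h2.trans (le_of_eq (by ring)))) (by simp)
    simpa using this
  have hpt : ∀ u, ‖∇ (fun x => Real.log (p x)) (reparam m s u)‖ ^ 2 ≤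
      2 * L ^ 2 * (‖reparam m s u‖ ^ 2 + ‖xstar‖ ^ 2) := by
    intro u
    have h6 := hp.score_sub_le (reparam m s u) xstar
    rw [hx, sub_zero] at h6
    have h7 := norm_sub_le (reparam m s u) xstar
    calc _ ≤ (L * (‖reparam m s u‖ + ‖xstar‖)) ^ 2 := by
          gcongr; exact h6.trans (by gcongr)
      _ ≤ _ := by
          rw [mul_pow]
          nlinarith [mul_nonneg (sq_nonneg L) (sq_nonneg (‖reparam m s u‖ - ‖xstar‖))]
  have hB : Integrable (fun u => 2 * L ^ 2 * (‖reparam m s u‖ ^ 2 + ‖xstar‖ ^ 2))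
      (ν.prod (stdNormal d)) := (h4.add (integrable_const _)).const_mul _
  have hSm := hp.continuous_score.measurable.comp hX
  have hSi : Integrable (fun u => ‖∇ (fun x => Real.log (p x)) (reparam m s u)‖ ^ 2)
      (ν.prod (stdNormal d)) :=
    hB.mono' (hSm.norm.pow_const 2).aestronglyMeasurable (ae_of_all _ fun u => by
      rw [Real.norm_of_nonneg (by positivity)]; exact hpt u)
  refine ⟨(memLp_two_iff_integrable_sq_norm hSm.aestronglyMeasurable).2 hSi,
    (integral_mono hSi hB hpt).trans ?_⟩
  rw [integral_const_mul, integral_add h4 (integrable_const _)]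
  simp only [integral_const, probReal_univ, one_smul]
  have h8 : L ^ 2 * (r ^ 2 + ‖xstar‖ ^ 2) ≤ 2 * √(L ^ 4 * (r ^ 4 + ‖xstar‖ ^ 4)) := by
    refine abs_le_of_sq_le_sq' ?_ (by positivity) |>.2
    rw [mul_pow, mul_pow, Real.sq_sqrt (by positivity)]
    nlinarith [mul_nonneg (by positivity : 0 ≤ L ^ 4) (sq_nonneg (r ^ 2 - ‖xstar‖ ^ 2)),
      mul_nonneg (by positivity : 0 ≤ L ^ 4) (by positivity : 0 ≤ r ^ 4 + ‖xstar‖ ^ 4)]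
  nlinarith [mul_le_mul_of_nonneg_left h5 (sq_nonneg L)]

/-- Splitting the square doubles both parts: the target score, and the noise ξ/σ, where the d
coordinates have variance one and 1/σ_i² ≤ L. -/
theorem integral_scoreGap_sq_le (hp : SmoothTarget p L M) (hm : Measurable m) (hs : Measurable s)
    (hL : 0 < L) (hs0 : ∀ z i, 1 / √L ≤ s z i)
    (hr : ∫⁻ x, ‖x‖ₑ ^ 4 ∂(densityMeasure (mixture ν m s)) ≤ ENNReal.ofReal (r ^ 4))
    {xstar : EuclideanSpace ℝ (Fin d)} (hx : ∇ (fun x => Real.log (p x)) xstar = 0) :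
    ∫ u, ‖scoreGap p m s u‖ ^ 2 ∂(ν.prod (stdNormal d)) ≤
      8 * √(L ^ 4 * (r ^ 4 + ‖xstar‖ ^ 4)) + 2 * (L * d) := by
  obtain ⟨h1, h2⟩ := memLp_score_reparam hp hm hs hL hs0 hr hx
  have hi : ∀ i : Fin d, Integrable (fun u : Z × (Fin d → ℝ) => u.2 i ^ 2)
      (ν.prod (stdNormal d)) := fun i => by
    have := (memLp_noise i).comp_measurePreserving
      (measurePreserving_snd (μ := ν) (ν := stdNormal d))
    exact (memLp_two_iff_integrable_sq this.aestronglyMeasurable).1 this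
  have hpt : ∀ u : Z × (Fin d → ℝ), ‖scoreGap p m s u‖ ^ 2 ≤
      2 * ‖∇ (fun x => Real.log (p x)) (reparam m s u)‖ ^ 2 + 2 * (L * ∑ i, u.2 i ^ 2) := by
    intro u
    have h3 : ‖diagMul u.2 (invVec (s u.1))‖ ^ 2 ≤ L * ∑ i, u.2 i ^ 2 := by
      rw [EuclideanSpace.norm_sq_eq, Finset.mul_sum]
      refine Finset.sum_le_sum fun i _ => ?_
      rw [diagMul_apply, invVec_apply, Real.norm_eq_abs, sq_abs, mul_pow, mul_comm, inv_pow]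
      gcongr
      exact inv_sq_le hL (hs0 u.1 i)
    have h4 := norm_add_le (∇ (fun x => Real.log (p x)) (reparam m s u))
      (diagMul u.2 (invVec (s u.1)))
    calc ‖scoreGap p m s u‖ ^ 2 ≤ (‖∇ (fun x => Real.log (p x)) (reparam m s u)‖ +
          ‖diagMul u.2 (invVec (s u.1))‖) ^ 2 := by gcongr; exact h4
      _ ≤ _ := by
          nlinarith [sq_nonneg (‖∇ (fun x => Real.log (p x)) (reparam m s u)‖ -
            ‖diagMul u.2 (invVec (s u.1))‖)]
  have hSi := h1.integrable_norm_pow (p := 2) (by norm_num)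
  have hN : Integrable (fun u : Z × (Fin d → ℝ) => ∑ i, u.2 i ^ 2) (ν.prod (stdNormal d)) :=
    integrable_finsetSum _ fun i _ => hi i
  have hG := (memLp_scoreGap hs hL hs0 h1).integrable_norm_pow (p := 2) (by norm_num)
  refine (integral_mono hG ((hSi.const_mul 2).add ((hN.const_mul L).const_mul 2)) hpt).trans ?_
  have hE : ∫ u : Z × (Fin d → ℝ), ∑ i, u.2 i ^ 2 ∂(ν.prod (stdNormal d)) = d := by
    rw [integral_finsetSum _ fun i _ => hi i]
    have : ∀ i : Fin d, ∫ u : Z × (Fin d → ℝ), u.2 i ^ 2 ∂(ν.prod (stdNormal d)) = 1 := fun i => by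
      rw [integral_fun_snd (μ := ν) (ν := stdNormal d) fun ξ : Fin d → ℝ => ξ i ^ 2]
      simp [integral_noise_sq]
    simp [this]
  simp only [Pi.add_apply]
  rw [integral_add (hSi.const_mul 2) ((hN.const_mul L).const_mul 2), integral_const_mul,
    integral_const_mul, integral_const_mul, hE]
  linarith

end Moments

/-! ### Assembly of the smoothness constant -/

theorem IsSmoothOn.congr {m : ℕ} {K : ℝ} {f g : EuclideanSpace ℝ (Fin m) → ℝ}
    {Φ : Set (EuclideanSpace ℝ (Fin m))} (hΦ : IsOpen Φ) (hf : IsSmoothOn K f Φ)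
    (h : ∀ φ ∈ Φ, g φ = f φ) : IsSmoothOn K g Φ := by
  have he : ∀ φ ∈ Φ, g =ᶠ[nhds φ] f := fun φ hφ =>
    Filter.eventually_of_mem (hΦ.mem_nhds hφ) h
  refine ⟨fun φ hφ => (hf.1 φ hφ).congr_of_eventuallyEq (he φ hφ), fun φ hφ ψ hψ => ?_⟩
  rw [gradient, gradient, (he φ hφ).fderiv_eq, (he ψ hψ).fderiv_eq]
  exact hf.2 φ hφ ψ hψ

theorem integral_add_add_const_sq_le {Ω : Type*} [MeasurableSpace Ω] {P : Measure Ω}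
    [IsProbabilityMeasure P] {g h : Ω → ℝ} (hg : MemLp g 2 P) (hh : MemLp h 2 P) {c : ℝ} (l : ℝ)
    (hgc : ∫ ω, g ω ^ 2 ∂P ≤ c) (hhc : ∫ ω, h ω ^ 2 ∂P ≤ c) :
    ∫ ω, (g ω + h ω + l) ^ 2 ∂P ≤ 3 * (2 * c + l ^ 2) := by
  have i1 : Integrable (fun ω => g ω ^ 2) P := hg.integrable_sq
  have i2 : Integrable (fun ω => h ω ^ 2) P := hh.integrable_sq
  have i12 : Integrable (fun ω => g ω ^ 2 + h ω ^ 2) P := i1.add i2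
  have i3 : Integrable (fun ω => 3 * (g ω ^ 2 + h ω ^ 2 + l ^ 2)) P :=
    (i12.add (integrable_const _)).const_mul 3
  have i4 : Integrable (fun ω => (g ω + h ω + l) ^ 2) P :=
    ((hg.add hh).add (memLp_const l)).integrable_sq
  refine (integral_mono i4 i3 fun ω => ?_).trans ?_
  · simp only
    nlinarith [sq_nonneg (g ω - h ω), sq_nonneg (g ω - l), sq_nonneg (h ω - l)]
  · rw [integral_const_mul, integral_add i12 (integrable_const _), integral_add i1 i2]
    simp only [integral_const, probReal_univ, one_smul]
    linarith

end KSIVI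

end

open KSIVI in
theorem theorem3 :
    -- `a` is the implicit constant of the moment bound on the mixing distribution
    ∀ a : ℝ, ∃ A : ℝ, 0 < A ∧
      ∀ (dz d m : ℕ), 1 ≤ dz → 2 ≤ d →
      -- the reproducing kernel Hilbert space `H` and its kernel `k`
      ∀ (H : Type) [NormedAddCommGroup H] [InnerProductSpace ℝ H] [CompleteSpace H]
        [RKHS ℝ H (EuclideanSpace ℝ (Fin d)) ℝ]
        (k : EuclideanSpace ℝ (Fin d) → EuclideanSpace ℝ (Fin d) → ℝ),
      (∀ x y, RKHS.kernel H x y (1 : ℝ) = k x y) →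
      ∀ (B L M G s : ℝ), 0 < B → 0 < L → 1 ≤ G →
      ∀ (p : EuclideanSpace ℝ (Fin d) → ℝ)
        (ν : Measure (EuclideanSpace ℝ (Fin dz))) [IsProbabilityMeasure ν]
        (Φ : Set (EuclideanSpace ℝ (Fin m)))
        (μ σ : EuclideanSpace ℝ (Fin dz) → EuclideanSpace ℝ (Fin m) →
          EuclideanSpace ℝ (Fin d)),
      IsOpen Φ → Convex ℝ Φ →
      KSIVI.BoundedKernel k B →
      KSIVI.SmoothTarget p L M →
      KSIVI.NetworkGrowth Φ μ G →
      KSIVI.NetworkGrowth Φ σ G →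
      (∀ z, ∀ φ ∈ Φ, ∀ i, 1 / √L ≤ σ z φ i) →
      ∫⁻ z, ‖z‖ₑ ^ 4 ∂ν ≤ ENNReal.ofReal (a * (dz : ℝ) ^ 2) →
      (∀ φ ∈ Φ, ∫⁻ x, ‖x‖ₑ ^ 4 ∂(KSIVI.densityMeasure (KSIVI.mixtureDensity ν μ σ φ))
        ≤ ENNReal.ofReal (s ^ 4)) →
      ∀ xstar : EuclideanSpace ℝ (Fin d), ∇ (fun x => Real.log (p x)) xstar = 0 →
      -- the loss is a genuine (not a junk) value
      (∀ φ ∈ Φ, MemLp (KSIVI.gradLogRatio p (KSIVI.mixtureDensity ν μ σ φ)) 2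
        (KSIVI.densityMeasure (KSIVI.mixtureDensity ν μ σ φ))) ∧
      KSIVI.IsSmoothOn
        (A * (B ^ 2 * G ^ 2 * (dz : ℝ) * Real.log d *
          ((max 1 L) ^ 3 + L * d + M ^ 2 + √(L ^ 4 * (s ^ 4 + ‖xstar‖ ^ 4)))))
        (KSIVI.loss H p ν μ σ) Φ := by
  intro a
  -- No sign is assumed on `a`; the moment hypothesis also holds with its positive part.
  set a' : ℝ := max a 0 with ha'
  have ha0 : 0 ≤ a' := le_max_right _ _
  -- 486000 = 18 · 150 · 180: the factors come from the energy estimate, the envelope moment and τ²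
  -- = 180R.
  refine ⟨486000 * (1 + a'), by positivity, ?_⟩
  intro dz d m hdz hd H _ _ _ _ k hk B L M G s hB hL hG p ν _ Φ μ σ hΦo hΦ hkB hp hμ hσ hσL hν hs
    xstar hx
  have hmeas : ∀ φ ∈ Φ, Measurable (fun z => μ z φ) ∧ Measurable (fun z => σ z φ) :=
    fun φ hφ => ⟨hμ.measurable φ hφ, hσ.measurable φ hφ⟩
  have hσL' : ∀ φ ∈ Φ, ∀ z i, 1 / √L ≤ σ z φ i := fun φ hφ z i => hσL z φ hφ i
  have hM := hp.nonneg_three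
  have hpd : Differentiable ℝ fun x => Real.log (p x) := hp.contDiff.differentiable (by norm_num)
  have hscore := fun φ hφ => memLp_score_reparam hp (hmeas φ hφ).1 (hmeas φ hφ).2 hL (hσL' φ hφ)
    (hs φ hφ) hx
  refine ⟨fun φ hφ => memLp_gradLogRatio hp.pos hpd hp.continuous_score (hmeas φ hφ).1
    (hmeas φ hφ).2 hL (hσL' φ hφ) (hscore φ hφ).1, ?_⟩
  have hν' : ∫⁻ z, ‖z‖ₑ ^ 4 ∂ν ≤ ENNReal.ofReal (a' * (dz : ℝ) ^ 2) :=
    hν.trans (ENNReal.ofReal_le_ofReal (by gcongr; exact le_max_left _ _))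
  obtain ⟨x', f', hfam⟩ := smoothFamily_reparam hΦo hΦ hL hG hp hμ hσ hσL
  obtain ⟨hb1, hb2⟩ := integral_envelope_pow_four_le ha0 hG hdz hd hν'
  have hgap := fun φ hφ => memLp_scoreGap (p := p) (hmeas φ hφ).2 hL (hσL' φ hφ) (hscore φ hφ).1
  have hgap2 := fun φ hφ => integral_scoreGap_sq_le hp (hmeas φ hφ).1 (hmeas φ hφ).2 hL
    (hσL' φ hφ) (hs φ hφ) hx
  set C := √(L ^ 4 * (s ^ 4 + ‖xstar‖ ^ 4)) with hC
  set R := (max 1 L) ^ 3 + L * d + M ^ 2 + C with hR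
  have hC0 : 0 ≤ C := Real.sqrt_nonneg _
  have hd0 : (0 : ℝ) ≤ d := Nat.cast_nonneg d
  have hR0 : 0 ≤ R := by positivity
  have hlog : 0 ≤ Real.log d := Real.log_nonneg (by exact_mod_cast (by omega : 1 ≤ d))
  -- The square of a sum of three terms is at most 3(M² + 16L² + 4L³), and both L² and L³ are at
  -- most (1 ∨ L)³, whence 48 + 12 = 60.
  have hl2 : (M + 4 * L + 2 * (L * √L)) ^ 2 ≤ 3 * M ^ 2 + 60 * (max 1 L) ^ 3 := by
    have h1 : (1 : ℝ) ≤ max 1 L := le_max_left _ _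
    have h2 : L ≤ max 1 L := le_max_right _ _
    have h3 : L ^ 2 ≤ (max 1 L) ^ 3 := by
      calc L ^ 2 ≤ (max 1 L) ^ 2 := by gcongr
        _ ≤ (max 1 L) ^ 3 := pow_le_pow_right₀ h1 (by norm_num)
    have h4 : (L * √L) ^ 2 ≤ (max 1 L) ^ 3 := by
      rw [mul_pow, Real.sq_sqrt hL.le, ← pow_succ]
      gcongr
    nlinarith [sq_nonneg (M - 4 * L), sq_nonneg (M - 2 * (L * √L)),
      sq_nonneg (4 * L - 2 * (L * √L))]
  have hτ : ∀ φ ∈ Φ, ∀ ψ ∈ Φ,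
      ∫ u, (‖scoreGap p (fun z => μ z φ) (fun z => σ z φ) u‖ +
        ‖scoreGap p (fun z => μ z ψ) (fun z => σ z ψ) u‖ + (M + 4 * L + 2 * (L * √L))) ^ 2
        ∂(ν.prod (stdNormal d)) ≤ √(180 * R) ^ 2 := by
    intro φ hφ ψ hψ
    -- With c = 8C + 2Ld the bound is 48C + 12Ld + 3l², and 3l² ≤ 9M² + 180(1 ∨ L)³ fixes the
    -- constant 180.
    refine (integral_add_add_const_sq_le (hgap φ hφ).norm (hgap ψ hψ).norm _ (hgap2 φ hφ)
      (hgap2 ψ hψ)).trans ?_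
    rw [Real.sq_sqrt (by positivity)]
    have : 0 ≤ (max 1 L) ^ 3 := by positivity
    have : 0 ≤ L * d := by positivity
    nlinarith [sq_nonneg M]
  have hmain := isSmoothOn_integral_interaction (P := ν.prod (stdNormal d))
    (hkB.smoothKernel H hk hB.le) hfam hΦo hΦ
    (fun φ hφ => measurable_reparam (hmeas φ hφ).1 (hmeas φ hφ).2)
    (fun φ hφ => measurable_scoreGap (hmeas φ hφ).1 (hmeas φ hφ).2 hp.continuous_score)
    (by unfold envelope; fun_prop) hb1 hgap (by positivity) (Real.sqrt_nonneg (180 * R)) hb2 hτ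
  rw [Real.sq_sqrt (by positivity)] at hmain
  have hK : 18 * B ^ 2 * (150 * (1 + a') * (G ^ 2 * dz * Real.log d)) * (180 * R) =
      486000 * (1 + a') * (B ^ 2 * G ^ 2 * (dz : ℝ) * Real.log d * R) := by ring
  rw [hK] at hmain
  exact hmain.congr hΦo fun φ hφ => ksd_mixture_sq H hk hB.le hkB hp.pos hpd hp.continuous_score
    (hmeas φ hφ).1 (hmeas φ hφ).2 hL (hσL' φ hφ) (hscore φ hφ).1
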